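/- Let $H^2$ be the Hardy space on the unit circle with normalised arc length $\mu$, i.e. the closed linear span of $\{e^{in\theta}\}_{n\ge 0}$ in $L^2(S^1,\mu)$, and let $P:L^2\to H^2$ be the orthogonal projection. For $s\ge 0$ let $$\Phi_s=\exp\Big(s\,\frac{e^{i\theta}+1}{e^{i\theta}-1}\Big)$$ and let $T_{\Phi_s}f=P(\Phi_s f)$ be the corresponding Toeplitz operator on $H^2$. Let $t>0$ be irrational, $\Gamma=\{m+nt: m,n\in\mathbb{Z}\}$ and $\Gamma_+=\{\gamma\in\Gamma:\gamma\ge 0\}$. For a set of operators on a Hilbert space, the $C^*$-algebra generated by it is the norm closure of the unital $*$-algebra it generates; $C^*(T_{\Phi_1},T_{\Phi_t})$ is the $C^*$-subalgebra of $B(H^2)$ generated by $T_{\Phi_1}$ and $T_{\Phi_t}$. For a representation $\pi$ of $\Gamma_+$, $C^*_\pi(\Gamma_+)$ is the $C^*$-algebra generated by the operators $\pi(\gamma)$, $\gamma\in\Gamma_+$. Let $\lambda:\Gamma_+\to B(\ell^2(\Gamma_+))$ be the regular isometric representation, $(\lambda(a)f)(b)=f(c)$ if $b=a+c$ with $c\in\Gamma_+$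 and $(\lambda(a)f)(b)=0$ otherwise, and let $C^*_{red}(\Gamma_+)=C^*_\lambda(\Gamma_+)$. Then: 1. for every $s\ge 0$, $T_{\Phi_s}f=\Phi_s f$ for all $f\in H^2$; 2. $\pi(m+nt)=T_{\Phi_{m+nt}}$ (for $m+nt\in\Gamma_+$) defines an isometric representation $\pi$ of $\Gamma_+$ on $H^2$, that is, $\pi(a+b)=\pi(a)\pi(b)$ for all $a,b\in\Gamma_+$ and every $\pi(a)$ is an isometry; 3. $C^*_\pi(\Gamma_+)=C^*(T_{\Phi_1},T_{\Phi_t})$; 4. $C^*(T_{\Phi_1},T_{\Phi_t})$ is canonically isomorphic to $C^*_{red}(\Gamma_+)$: there is a $*$-isomorphism $\tau:C^*(T_{\Phi_1},T_{\Phi_t})\to C^*_{red}(\Gamma_+)$ with $\tau(T_{\Phi_\gamma})=\lambda(\gamma)$ for all $\gamma\in\Gamma_+$. -/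

import Mathlib

open MeasureTheory ComplexConjugate
open scoped ENNReal InnerProductSpace

noncomputable section

namespace ToeplitzExt

/-! ### Isometric representations and the C*-algebras they generate -/

section Representations

variable {S : Type*} {H H₁ H₂ : Type*}
  [NormedAddCommGroup H] [InnerProductSpace ℂ H] [CompleteSpace H]
  [NormedAddCommGroup H₁] [InnerProductSpace ℂ H₁] [CompleteSpace H₁]
  [NormedAddCommGroup H₂] [InnerProductSpace ℂ H₂] [CompleteSpace H₂]

/-- An isometric representation of an additive semigroup: a homomorphism into the multiplicative
semigroup of isometries of a Hilbert space. -/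
structure IsIsometricRep [Add S] (π : S → H →L[ℂ] H) : Prop where
  map_add : ∀ a b, π (a + b) = π a * π b
  isometry : ∀ a, Isometry (π a)

/-- The C*-subalgebra of `B(H)` generated by a set of operators: the norm closure of the
unital star subalgebra generated by the set. -/
def cstarGenerated (s : Set (H →L[ℂ] H)) : StarSubalgebra ℂ (H →L[ℂ] H) :=
  (StarAlgebra.adjoin ℂ s).topologicalClosure

theorem mem_cstarGenerated {s : Set (H →L[ℂ] H)} {T : H →L[ℂ] H} (hT : T ∈ s) :
    T ∈ cstarGenerated s :=
  StarSubalgebra.le_topologicalClosure _ (StarAlgebra.subset_adjoin ℂ s hT)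

/-- The C*-algebra `C*_π(S)` generated by the operators `π a`. -/
def cstarRep (π : S → H →L[ℂ] H) : StarSubalgebra ℂ (H →L[ℂ] H) :=
  cstarGenerated (Set.range π)

/-- The operator `π a`, as an element of `C*_π(S)`. -/
def toCstarRep (π : S → H →L[ℂ] H) (a : S) : cstarRep π :=
  ⟨π a, mem_cstarGenerated (Set.mem_range_self a)⟩

/-- `C*_{π₁}(S)` and `C*_{π₂}(S)` are canonically isomorphic: there is a star-isomorphism `τ`
with `τ ∘ π₁ = π₂`. -/
def CanonicallyIsomorphic (π₁ : S → H₁ →L[ℂ] H₁) (π₂ : S → H₂ →L[ℂ] H₂) : Prop :=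
  ∃ τ : cstarRep π₁ ≃⋆ₐ[ℂ] cstarRep π₂, ∀ a, τ (toCstarRep π₁ a) = toCstarRep π₂ a

end Representations

/-! ### The regular isometric representation -/

section Regular

variable {S : Type*} [AddCommSemigroup S] [IsCancelAdd S]

/-- The function `b ↦ f c` if `b = a + c`, and `b ↦ 0` if `b` is not in `a + S`. -/
def shiftFun (a : S) (f : S → ℂ) : S → ℂ :=
  Function.extend (fun c => a + c) f (fun _ => 0)

theorem shiftFun_add (a c : S) (f : S → ℂ) : shiftFun a f (a + c) = f c :=
  (add_right_injective a).extend_apply f (fun _ => 0) c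

theorem shiftFun_of_notMem (a b : S) (f : S → ℂ) (h : ¬ ∃ c, b = a + c) : shiftFun a f b = 0 :=
  Function.extend_apply' f (fun _ => 0) b (fun ⟨c, hc⟩ => h ⟨c, hc.symm⟩)

theorem hasSum_shiftFun (a : S) (f : lp (fun _ : S => ℂ) 2) :
    HasSum (fun b => ‖shiftFun a f b‖ ^ (2 : ℝ≥0∞).toReal) (‖f‖ ^ (2 : ℝ≥0∞).toReal) := by
  have h := lp.hasSum_norm (p := 2) (by norm_num) f
  refine ((add_right_injective a).hasSum_iff ?_).1 (by
    simpa only [Function.comp_def, shiftFun_add] using h)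
  intro b hb
  rw [shiftFun_of_notMem a b f (fun ⟨c, hc⟩ => hb ⟨c, hc.symm⟩)]
  simp

/-- The operator of the regular representation at `a`, as a linear isometry of `ℓ²(S)`. -/
def regularIsometry (a : S) : lp (fun _ : S => ℂ) 2 →ₗᵢ[ℂ] lp (fun _ : S => ℂ) 2 where
  toFun f := ⟨shiftFun a f, memℓp_gen (hasSum_shiftFun a f).summable⟩
  map_add' f g := by
    ext b
    change shiftFun a (f + g : lp (fun _ : S => ℂ) 2) b = shiftFun a f b + shiftFun a g b
    by_cases h : ∃ c, b = a + c
    · obtain ⟨c, rfl⟩ := h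
      simp only [shiftFun_add]
      rfl
    · simp only [shiftFun_of_notMem a b _ h, add_zero]
  map_smul' k f := by
    ext b
    by_cases h : ∃ c, b = a + c
    · obtain ⟨c, rfl⟩ := h
      simp [shiftFun_add]
    · simp [shiftFun_of_notMem a b _ h]
  norm_map' f := by
    have h := lp.norm_rpow_eq_tsum (p := 2) (by norm_num)
      (⟨shiftFun a f, memℓp_gen (hasSum_shiftFun a f).summable⟩ : lp (fun _ : S => ℂ) 2)
    rw [(hasSum_shiftFun a f).tsum_eq] at h
    exact (Real.rpow_left_inj (norm_nonneg _) (norm_nonneg _) (by norm_num)).1 h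

/-- The regular isometric representation of `S` on `ℓ²(S)`. -/
def regularRep (a : S) : lp (fun _ : S => ℂ) 2 →L[ℂ] lp (fun _ : S => ℂ) 2 :=
  (regularIsometry a).toContinuousLinearMap

theorem regularRep_apply_add (a c : S) (f : lp (fun _ : S => ℂ) 2) :
    regularRep a f (a + c) = f c :=
  shiftFun_add a c f

theorem regularRep_apply_of_notMem (a b : S) (f : lp (fun _ : S => ℂ) 2)
    (h : ¬ ∃ c, b = a + c) : regularRep a f b = 0 :=
  shiftFun_of_notMem a b f h

theorem isIsometricRep_regularRep :
    IsIsometricRep (regularRep : S → lp (fun _ : S => ℂ) 2 →L[ℂ] lp (fun _ : S => ℂ) 2) where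
  map_add a b := by
    ext f d
    change regularRep (a + b) f d = regularRep a (regularRep b f) d
    by_cases h : ∃ c, d = a + c
    · obtain ⟨c, rfl⟩ := h
      rw [regularRep_apply_add]
      by_cases h' : ∃ e, c = b + e
      · obtain ⟨e, rfl⟩ := h'
        rw [← add_assoc, regularRep_apply_add, regularRep_apply_add]
      · rw [regularRep_apply_of_notMem b c f h', regularRep_apply_of_notMem]
        rintro ⟨e, he⟩
        exact h' ⟨e, add_left_cancel (a := a) (by rw [he, add_assoc])⟩
    · rw [regularRep_apply_of_notMem a d _ h, regularRep_apply_of_notMem]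
      rintro ⟨e, he⟩
      exact h ⟨b + e, by rw [he, add_assoc]⟩
  isometry a := (regularIsometry a).isometry

end Regular

/-! ### The Hardy space and Toeplitz operators -/

instance factTwoPiPos : Fact (0 < 2 * Real.pi) := ⟨Real.two_pi_pos⟩

/-- The unit circle, with the angle `θ` as coordinate. -/
abbrev Angle : Type := AddCircle (2 * Real.pi)

/-- Normalised arc length on the circle. -/
abbrev arcMeasure : Measure Angle := AddCircle.haarAddCircle

/-- The Hardy space `H²`: the closed linear span of the functions `e^{inθ}`, `n ≥ 0`, in `L²`. -/
def hardy : Submodule ℂ (Lp ℂ 2 arcMeasure) :=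
  (Submodule.span ℂ (Set.range fun n : ℕ => fourierLp (T := 2 * Real.pi) 2 (n : ℤ))).topologicalClosure

instance completeSpace_hardy : CompleteSpace hardy :=
  Submodule.topologicalClosure.completeSpace _

/-- The operator on `L²` of multiplication by a bounded function `φ`. -/
def mulOp (φ : Lp ℂ ∞ arcMeasure) : Lp ℂ 2 arcMeasure →L[ℂ] Lp ℂ 2 arcMeasure :=
  (ContinuousLinearMap.mul ℂ ℂ).holderL arcMeasure ∞ 2 2 φ

/-- The Toeplitz operator `T_φ f = P (φ f)` on `H²`, with `P` the orthogonal projection of `L²`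
onto `H²`. If `φ H² ⊆ H²`, as for an inner function `φ`, this is multiplication by `φ`. -/
def toeplitz (φ : Lp ℂ ∞ arcMeasure) : hardy →L[ℂ] hardy :=
  hardy.orthogonalProjectionOnto ∘L mulOp φ ∘L hardy.subtypeL

/-! ### The singular inner functions -/

/-- `Φ_s = exp (s (e^{iθ} + 1) / (e^{iθ} - 1))`. -/
def singularInner (s : ℝ) (θ : Angle) : ℂ :=
  Complex.exp (s * ((fourier 1 θ + 1) / (fourier 1 θ - 1)))

theorem norm_singularInner (s : ℝ) (θ : Angle) : ‖singularInner s θ‖ = 1 := by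
  have hz : fourier 1 θ * conj (fourier 1 θ : ℂ) = 1 := by
    rw [Complex.mul_conj, Complex.normSq_eq_norm_sq]
    have : ‖(fourier 1 θ : ℂ)‖ = 1 := by rw [fourier_one]; exact Circle.norm_coe _
    rw [this]
    norm_num
  rw [singularInner, Complex.norm_exp, Real.exp_eq_one_iff, Complex.re_ofReal_mul]
  generalize (fourier 1 θ : ℂ) = z at hz
  suffices h : ((z + 1) / (z - 1)).re = 0 by rw [h, mul_zero]
  rw [Complex.mul_conj] at hz
  have hz' : z.re * z.re + z.im * z.im = 1 := by
    rw [← Complex.normSq_apply]; exact_mod_cast hz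
  rw [Complex.div_re, ← add_div]
  simp only [Complex.add_re, Complex.sub_re, Complex.add_im, Complex.sub_im, Complex.one_re,
    Complex.one_im]
  rw [div_eq_zero_iff]
  left
  linear_combination hz'

theorem measurable_singularInner (s : ℝ) : Measurable (singularInner s) := by
  unfold singularInner
  have h : Measurable (fun θ : Angle => (fourier 1 θ : ℂ)) := (fourier 1).continuous.measurable
  fun_prop

theorem memLp_singularInner (s : ℝ) : MemLp (singularInner s) ∞ arcMeasure :=
  memLp_top_of_bound (measurable_singularInner s).aestronglyMeasurable 1
    (.of_forall fun θ => (norm_singularInner s θ).le)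

/-- The operator `T_{Φ_s}` on `H²`. -/
def toeplitzSingular (s : ℝ) : hardy →L[ℂ] hardy :=
  toeplitz (memLp_singularInner s).toLp

/-! ### The ordered group `ℤ + tℤ` -/

/-- The group `Γ = ℤ + tℤ` of the numbers `m + n t`. -/
def latticeGroup (t : ℝ) : AddSubgroup ℝ where
  carrier := {x | ∃ m n : ℤ, x = m + n * t}
  zero_mem' := ⟨0, 0, by simp⟩
  add_mem' := by
    rintro _ _ ⟨m, n, rfl⟩ ⟨m', n', rfl⟩
    exact ⟨m + m', n + n', by push_cast; ring⟩
  neg_mem' := by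
    rintro _ ⟨m, n, rfl⟩
    exact ⟨-m, -n, by push_cast; ring⟩

/-- The semigroup `Γ₊ = Γ ∩ ℝ₊` of the nonnegative elements of `Γ`. -/
def latticeCone (t : ℝ) : AddSubmonoid ℝ where
  carrier := {x | x ∈ latticeGroup t ∧ 0 ≤ x}
  zero_mem' := ⟨zero_mem _, le_rfl⟩
  add_mem' := fun h h' => ⟨add_mem h.1 h'.1, add_nonneg h.2 h'.2⟩

/-- The map `m + n t ↦ T_{Φ_{m + n t}}` on `Γ₊`. -/
def coneRep (t : ℝ) (γ : latticeCone t) : hardy →L[ℂ] hardy :=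
  toeplitzSingular γ

end ToeplitzExt

end

/-! The isomorphism in part 4 holds for any isometric representation `V` of a totally ordered cone
`S` that embeds in `ℤ × ℤ`, provided `V a` is non-surjective for `a ≠ 0`. It comes from comparing
the norms of `V` and the regular representation `λ` on noncommutative polynomials. Since `S` is
totally ordered, every polynomial is a combination of monomials `V a * star (V b)`, and the pair `(V
a, λ a)` expands both versions with the same coefficients.

Upper bound (`norm_fst_le_norm_snd`). Twist `V` by the characters of `ℤ × ℤ` and sum `‖z h‖²` over
finitely many twists. Only the diagonal monomials of `star z * z` survive, leaving `∑ l (a, a) *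
‖star (V a) h‖²`. The weights decrease in `a`, and the partial sums of the coefficients are the
values `‖λ(z) δ_r‖²`, so Abel summation bounds the total by `‖λ(z)‖² ‖h‖²`. The price is the number
of characters used, which is polynomial in the degree. Applying the estimate to `(star z * z) ^ 2 ^
n`, whose degree bound is linear in `2 ^ n`, and extracting roots removes it.

Lower bound (`norm_snd_le_norm_fst`). For any finite set of nonzero elements, non-surjectivity at
the least one gives a unit vector `f` killed by `star (V e)` for every `e` in the set. Then the
vectors `V s f` imitate the basis `δ_s` on any prescribed finite set of matrix entries.

For `V = T_Φ`, radial limits of holomorphic functions show that `Φ_s` maps `H²` into itself.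
Surjectivity with `s > 0` would put both `Φ_s` and its conjugate in `H²`, making `Φ_s` constant.
Irrationality of `t` gives the embedding into `ℤ × ℤ`. -/

noncomputable section

namespace ToeplitzExt

set_option linter.unusedSectionVars false

/-! ### Isometric homomorphisms into star algebras -/

section Monomials

variable {S A : Type*} [AddCommMonoid S] [Ring A] [StarRing A]

/-- A homomorphism of an additive semigroup into the isometries of a star algebra. -/
structure IsIsometricHom (W : S → A) : Prop where
  map_add : ∀ a b, W (a + b) = W a * W b
  star_mul_self : ∀ a, star (W a) * W a = 1

namespace IsIsometricHom

variable {W : S → A}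

theorem map_zero (hW : IsIsometricHom W) : W 0 = 1 := by
  have h := hW.map_add 0 0
  rw [add_zero] at h
  calc W 0 = star (W 0) * W 0 * W 0 := by rw [hW.star_mul_self, one_mul]
    _ = star (W 0) * W 0 := by rw [mul_assoc, ← h]
    _ = 1 := hW.star_mul_self 0

theorem star_mul_add (hW : IsIsometricHom W) (b k : S) : star (W b) * W (b + k) = W k := by
  rw [hW.map_add, ← mul_assoc, hW.star_mul_self, one_mul]

theorem star_add_mul (hW : IsIsometricHom W) (b k : S) :
    star (W (b + k)) * W b = star (W k) := by
  have h := congrArg star (hW.star_mul_add b k)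
  rwa [star_mul, star_star] at h

end IsIsometricHom

variable [Algebra ℂ A]

/-- The span of the monomials `W a * star (W b)` whose degree `d a - d b` has entries of absolute
value at most `K`. -/
def monomialSpan (d : S →+ ℤ × ℤ) (W : S → A) (K : ℕ) : Submodule ℂ A :=
  Submodule.span ℂ ((fun p : S × S => W p.1 * star (W p.2)) ''
    {p | |(d p.1 - d p.2).1| ≤ K ∧ |(d p.1 - d p.2).2| ≤ K})

variable {d : S →+ ℤ × ℤ} {W : S → A} {K L : ℕ}

theorem monomial_mem_monomialSpan {a b : S} (h₁ : |(d a - d b).1| ≤ K)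
    (h₂ : |(d a - d b).2| ≤ K) : W a * star (W b) ∈ monomialSpan d W K :=
  Submodule.subset_span ⟨(a, b), ⟨h₁, h₂⟩, rfl⟩

theorem monomialSpan_mono (h : K ≤ L) : monomialSpan d W K ≤ monomialSpan d W L := by
  have h' : (K : ℤ) ≤ L := by exact_mod_cast h
  exact Submodule.span_mono (Set.image_mono fun p hp => ⟨hp.1.trans h', hp.2.trans h'⟩)

theorem exists_finsupp_of_mem_monomialSpan {x : A} (hx : x ∈ monomialSpan d W K) :
    ∃ l : S × S →₀ ℂ, (∀ p ∈ l.support, |(d p.1 - d p.2).1| ≤ K ∧ |(d p.1 - d p.2).2| ≤ K) ∧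
      x = ∑ p ∈ l.support, l p • (W p.1 * star (W p.2)) := by
  obtain ⟨l, hl, rfl⟩ := (Finsupp.mem_span_image_iff_linearCombination ℂ).1 hx
  exact ⟨l, fun p hp => (Finsupp.mem_supported ℂ l).1 hl hp, rfl⟩

theorem one_mem_monomialSpan (hW : IsIsometricHom W) : 1 ∈ monomialSpan d W K := by
  have := monomial_mem_monomialSpan (W := W) (d := d) (K := K) (a := 0) (b := 0)
    (by simp) (by simp)
  simpa [hW.map_zero] using this

theorem star_mem_monomialSpan [StarModule ℂ A] {x : A} (hx : x ∈ monomialSpan d W K) :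
    star x ∈ monomialSpan d W K := by
  induction hx using Submodule.span_induction with
  | mem x h =>
    obtain ⟨p, ⟨h₁, h₂⟩, rfl⟩ := h
    rw [star_mul, star_star]
    refine monomial_mem_monomialSpan ?_ ?_
    · rwa [← neg_sub, Prod.fst_neg, abs_neg]
    · rwa [← neg_sub, Prod.snd_neg, abs_neg]
  | zero => simp
  | add x y _ _ hx hy => rw [star_add]; exact add_mem hx hy
  | smul c x _ hx => rw [star_smul]; exact Submodule.smul_mem _ _ hx

variable [LinearOrder S] [CanonicallyOrderedAdd S]

/-- In a product of monomials the middle factor `star (W b) * W c` collapses to one `W k` or `star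
(W k)`, because `b` and `c` are comparable. Degrees add, so the product is again a single monomial.
-/
theorem mul_mem_monomialSpan (hW : IsIsometricHom W) {x y : A} (hx : x ∈ monomialSpan d W K)
    (hy : y ∈ monomialSpan d W L) : x * y ∈ monomialSpan d W (K + L) := by
  induction hx using Submodule.span_induction with
  | zero => simp
  | add x x' _ _ hx hx' => rw [add_mul]; exact add_mem hx hx'
  | smul c x _ hx => rw [smul_mul_assoc]; exact Submodule.smul_mem _ _ hx
  | mem x h =>
    obtain ⟨⟨a, b⟩, ⟨h₁, h₂⟩, rfl⟩ := h
    induction hy using Submodule.span_induction with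
    | zero => simp
    | add y y' _ _ hy hy' => rw [mul_add]; exact add_mem hy hy'
    | smul c y _ hy => rw [mul_smul_comm]; exact Submodule.smul_mem _ _ hy
    | mem y h =>
      obtain ⟨⟨c, e⟩, ⟨h₃, h₄⟩, rfl⟩ := h
      simp only [Prod.fst_sub, Prod.snd_sub] at h₁ h₂ h₃ h₄
      dsimp only
      rw [abs_le] at h₁ h₂ h₃ h₄
      rcases le_total b c with h | h
      · obtain ⟨k, rfl⟩ := le_iff_exists_add.1 h
        have : W a * star (W b) * (W (b + k) * star (W e)) = W (a + k) * star (W e) := by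
          rw [mul_assoc, ← mul_assoc (star (W b)), hW.star_mul_add, hW.map_add, mul_assoc]
        rw [this]
        simp only [map_add, Prod.fst_add, Prod.snd_add] at h₃ h₄
        refine monomial_mem_monomialSpan ?_ ?_ <;> rw [abs_le] <;> constructor <;>
          simp only [map_add, Prod.fst_add, Prod.snd_add, Prod.fst_sub, Prod.snd_sub] <;>
          push_cast <;> linarith
      · obtain ⟨k, rfl⟩ := le_iff_exists_add.1 h
        have : W a * star (W (c + k)) * (W c * star (W e)) = W a * star (W (e + k)) := by
          rw [mul_assoc, ← mul_assoc (star (W (c + k))), hW.star_add_mul, hW.map_add, star_mul]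
        rw [this]
        simp only [map_add, Prod.fst_add, Prod.snd_add] at h₁ h₂
        refine monomial_mem_monomialSpan ?_ ?_ <;> rw [abs_le] <;> constructor <;>
          simp only [map_add, Prod.fst_add, Prod.snd_add, Prod.fst_sub, Prod.snd_sub] <;>
          push_cast <;> linarith

theorem pow_mem_monomialSpan (hW : IsIsometricHom W) {x : A} (hx : x ∈ monomialSpan d W K)
    (n : ℕ) : x ^ n ∈ monomialSpan d W (n * K) := by
  induction n with
  | zero => simpa using one_mem_monomialSpan hW
  | succ n ih => rw [pow_succ, add_one_mul]; exact mul_mem_monomialSpan hW ih hx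

theorem exists_mem_monomialSpan [StarModule ℂ A] (d : S →+ ℤ × ℤ) (hW : IsIsometricHom W) {x : A}
    (hx : x ∈ StarAlgebra.adjoin ℂ (Set.range W)) : ∃ K, x ∈ monomialSpan d W K := by
  induction hx using StarAlgebra.adjoin_induction with
  | mem x h =>
    obtain ⟨a, rfl⟩ := h
    refine ⟨(d a).1.natAbs + (d a).2.natAbs, ?_⟩
    rw [← mul_one (W a), ← star_one, ← hW.map_zero]
    refine monomial_mem_monomialSpan ?_ ?_ <;> simp
  | algebraMap r =>
    exact ⟨0, by rw [Algebra.algebraMap_eq_smul_one];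
                 exact Submodule.smul_mem _ _ (one_mem_monomialSpan hW)⟩
  | add x y _ _ hx hy =>
    obtain ⟨K, hK⟩ := hx
    obtain ⟨L, hL⟩ := hy
    exact ⟨max K L, add_mem (monomialSpan_mono (le_max_left _ _) hK)
      (monomialSpan_mono (le_max_right _ _) hL)⟩
  | mul x y _ _ hx hy =>
    obtain ⟨K, hK⟩ := hx
    obtain ⟨L, hL⟩ := hy
    exact ⟨K + L, mul_mem_monomialSpan hW hK hL⟩
  | star x _ hx => exact hx.imp fun K hK => star_mem_monomialSpan hK

end Monomials

/-! ### Two scalar estimates -/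

/-- Abel summation: a sum with decreasing weights is controlled by the partial sums. -/
theorem norm_sum_mul_le_of_partialSums {S : Type*} [LinearOrder S] (c : S → ℂ) {M : ℝ}
    (hM : 0 ≤ M) (s : Finset S) (hc : ∀ r, ‖∑ a ∈ s with a ≤ r, c a‖ ≤ M) {B : ℝ} (hB : 0 ≤ B)
    {p : S → ℝ} (hp : AntitoneOn p s) (hp₀ : ∀ a ∈ s, 0 ≤ p a) (hpB : ∀ a ∈ s, p a ≤ B) :
    ‖∑ a ∈ s, c a * p a‖ ≤ M * B := by
  induction s using Finset.induction_on_max generalizing B p with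
  | empty => simpa using mul_nonneg hM hB
  | insert m s hm ih =>
    have hms : m ∉ s := fun h => (hm m h).false
    have hm' : m ∈ insert m s := Finset.mem_insert_self m s
    have hs : ∀ a ∈ s, a ∈ insert m s := fun a => Finset.mem_insert_of_mem
    have hpm : ∀ a ∈ s, p m ≤ p a := fun a ha =>
      hp (by simpa using hs a ha) (by simp) (hm a ha).le
    -- Lower all weights by the smallest one, `p m`. The term at `m` disappears from the first sum,
    -- and the correction is `p m` times a full partial sum.
    have hsum : ∑ a ∈ insert m s, c a * p a =
        ∑ a ∈ s, c a * ((p a - p m : ℝ) : ℂ) + (∑ a ∈ insert m s, c a) * p m := by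
      simp only [Finset.sum_insert hms, Complex.ofReal_sub, mul_sub, Finset.sum_sub_distrib,
        add_mul, Finset.sum_mul]
      ring
    have h₁ : ‖∑ a ∈ s, c a * ((p a - p m : ℝ) : ℂ)‖ ≤ M * (B - p m) := by
      refine ih (fun r => ?_) (sub_nonneg.2 (hpB m hm')) (fun a ha b hb hab => ?_)
        (fun a ha => sub_nonneg.2 (hpm a ha)) fun a ha => sub_le_sub_right (hpB a (hs a ha)) _
      · rcases lt_or_ge r m with hr | hr
        · simpa [Finset.filter_insert, hr.not_ge] using hc r
        -- A cutoff `r ≥ m` takes in all of `s`. Cutting `insert m s` at the maximum of `s` gives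
        -- the same sum without `m`.
        · rcases s.eq_empty_or_nonempty with rfl | hne
          · simpa using hM
          · have hlt := (Finset.max'_lt_iff s hne).2 hm
            convert hc (s.max' hne) using 3
            rw [Finset.filter_insert, if_neg hlt.not_ge]
            exact Finset.filter_congr fun a ha =>
              ⟨fun _ => s.le_max' a ha, fun _ => (hm a ha).le.trans hr⟩
      · exact sub_le_sub_right (hp (by simpa using hs a ha) (by simpa using hs b hb) hab) _
    have h₂ : ‖(∑ a ∈ insert m s, c a) * p m‖ ≤ M * p m := by
      rw [norm_mul, Complex.norm_real, Real.norm_of_nonneg (hp₀ m hm')]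
      refine mul_le_mul_of_nonneg_right ?_ (hp₀ m hm')
      have hall : ∀ a ∈ insert m s, a ≤ m := fun a ha => by
        rcases Finset.mem_insert.1 ha with rfl | ha
        exacts [le_rfl, (hm a ha).le]
      simpa only [Finset.filter_true_of_mem hall] using hc m
    calc _ ≤ M * (B - p m) + M * p m := hsum ▸ norm_add_le_of_le h₁ h₂
      _ = M * B := by ring

/-- The character of `ℤ × ℤ` with angles `θ`. -/
def phase (θ : ℝ × ℝ) (v : ℤ × ℤ) : ℂ :=
  Complex.exp ((θ.1 * v.1 + θ.2 * v.2 : ℝ) * Complex.I)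

theorem phase_add (θ : ℝ × ℝ) (v w : ℤ × ℤ) : phase θ (v + w) = phase θ v * phase θ w := by
  rw [phase, phase, phase, ← Complex.exp_add]
  push_cast [Prod.fst_add, Prod.snd_add]
  ring_nf

theorem star_phase (θ : ℝ × ℝ) (v : ℤ × ℤ) : star (phase θ v) = phase θ (-v) := by
  rw [phase, phase, Complex.star_def, ← Complex.exp_conj, map_mul, Complex.conj_ofReal,
    Complex.conj_I]
  push_cast [Prod.fst_neg, Prod.snd_neg]
  ring_nf

@[simp] theorem phase_zero_right (θ : ℝ × ℝ) : phase θ 0 = 1 := by simp [phase]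

@[simp] theorem phase_zero_left (v : ℤ × ℤ) : phase 0 v = 1 := by simp [phase]

theorem star_phase_mul_phase (θ : ℝ × ℝ) (v : ℤ × ℤ) : star (phase θ v) * phase θ v = 1 := by
  rw [star_phase, ← phase_add, neg_add_cancel, phase_zero_right]

/-- The angles of the `j`-th of `(2 K + 1) ^ 2` characters that separate the degrees of size at
most `K` from `0`. -/
def sampleAngle (K j : ℕ) : ℝ × ℝ :=
  (2 * Real.pi * j / (2 * K + 1) ^ 2, 2 * Real.pi * j * (2 * K + 1) / (2 * K + 1) ^ 2)

/-- The degree `v` is encoded in base `2 * K + 1` as `k = v.1 + (2 * K + 1) * v.2`, and the sum is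
geometric in an `N`-th root of unity with `N = (2 * K + 1) ^ 2`. Since `|k| ≤ 2 * K * (K + 1) < N`,
the root is `1` only for `k = 0`, which forces `v = 0`. -/
theorem sum_phase_sampleAngle {K : ℕ} {v : ℤ × ℤ} (h₁ : |v.1| ≤ K) (h₂ : |v.2| ≤ K) :
    ∑ j ∈ Finset.range ((2 * K + 1) ^ 2), phase (sampleAngle K j) v =
      if v = 0 then (2 * K + 1 : ℂ) ^ 2 else 0 := by
  split_ifs with hv
  · simp [hv]
  set k : ℤ := v.1 + (2 * K + 1) * v.2 with hk
  set N : ℕ := (2 * K + 1) ^ 2 with hN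
  have hN0 : (N : ℂ) ≠ 0 := by rw [hN]; exact_mod_cast (by positivity)
  set w : ℂ := Complex.exp (2 * Real.pi * Complex.I * (k / N)) with hw
  have hpow : ∀ j ∈ Finset.range N, phase (sampleAngle K j) v = w ^ j := by
    intro j _
    rw [phase, sampleAngle, hw, ← Complex.exp_nat_mul, hk, hN]
    congr 1
    push_cast
    ring
  rw [Finset.sum_congr rfl hpow]
  have hwN : w ^ N = 1 := by
    rw [hw, ← Complex.exp_nat_mul, Complex.exp_eq_one_iff]
    exact ⟨k, by field_simp⟩
  have hw1 : w ≠ 1 := by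
    intro h
    obtain ⟨q, hq⟩ := Complex.exp_eq_one_iff.1 (hw ▸ h)
    have hkq : (k : ℂ) = q * N := by
      have h2 : (2 * Real.pi * Complex.I : ℂ) ≠ 0 := Complex.two_pi_I_ne_zero
      have : (k / N : ℂ) = q := mul_left_cancel₀ h2 (by rw [hq]; ring)
      rw [← this]; field_simp
    have hkq' : k = q * (2 * K + 1) ^ 2 := by
      rw [hN] at hkq
      exact_mod_cast hkq
    rw [abs_le] at h₁ h₂
    have hq0 : q = 0 := by
      by_contra hq0
      rcases Int.lt_or_gt_of_ne hq0 with h | h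
      · nlinarith
      · nlinarith
    rw [hq0, zero_mul] at hkq'
    have hv2 : v.2 = 0 := by
      by_contra hv2
      rcases Int.lt_or_gt_of_ne hv2 with h | h
      · nlinarith
      · nlinarith
    exact hv (Prod.ext (by rw [hk, hv2] at hkq'; simpa using hkq') hv2)
  have := mul_geom_sum w N
  rw [hwN, sub_self] at this
  exact (mul_eq_zero.1 this).resolve_left (sub_ne_zero.2 hw1)

/-- A number whose powers are dominated by those of another one up to a linear factor is at most
that number. -/
theorem le_of_pow_le_mul_pow {r q C : ℝ} (hq : 0 ≤ q)
    (h : ∀ n : ℕ, r ^ 2 ^ n ≤ (C * 2 ^ n + 1) * q ^ 2 ^ n) : r ≤ q := by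
  by_contra! hqr
  have hr : 0 < r := hq.trans_lt hqr
  have hx : |q / r| < 1 := by
    rw [abs_of_nonneg (by positivity)]
    exact (div_lt_one hr).2 hqr
  -- If `q < r`, the hypothesis says that this sequence is at least `1` along `m = 2 ^ n`, yet
  -- geometric decay beats the linear factor.
  have hlim : Filter.Tendsto (fun m : ℕ => (C * m + 1) * (q / r) ^ m) Filter.atTop (nhds 0) := by
    have h₁ := (tendsto_pow_const_mul_const_pow_of_abs_lt_one 1 hx).const_mul C
    have h₀ := tendsto_pow_const_mul_const_pow_of_abs_lt_one 0 hx
    simpa [add_mul, mul_assoc] using h₁.add h₀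
  have hlim' := hlim.comp (tendsto_pow_atTop_atTop_of_one_lt (one_lt_two (α := ℕ)))
  refine absurd (ge_of_tendsto' hlim' fun n => ?_) (not_le.2 (zero_lt_one (α := ℝ)))
  rw [Function.comp_apply, div_pow, ← mul_div_assoc, le_div_iff₀ (by positivity), one_mul]
  simpa using h n

/-! ### Upper bound: the regular representation dominates every isometric one -/

section Comparison

variable {S : Type*} [AddCommMonoid S] {H : Type*} [NormedAddCommGroup H] [InnerProductSpace ℂ H]
  [CompleteSpace H]

theorem IsIsometricRep.isIsometricHom {V : S → H →L[ℂ] H} (hV : IsIsometricRep V) :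
    IsIsometricHom V where
  map_add := hV.map_add
  star_mul_self a := (V a).norm_map_iff_adjoint_comp_self.1
    ((AddMonoidHomClass.isometry_iff_norm (V a)).1 (hV.isometry a))

theorem IsIsometricRep.norm_apply {V : S → H →L[ℂ] H} (hV : IsIsometricRep V) (a : S) (h : H) :
    ‖V a h‖ = ‖h‖ :=
  (AddMonoidHomClass.isometry_iff_norm (V a)).1 (hV.isometry a) h

theorem IsIsometricRep.norm_star_apply_le {V : S → H →L[ℂ] H} (hV : IsIsometricRep V) (a : S)
    (h : H) : ‖star (V a) h‖ ≤ ‖h‖ := by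
  have h₁ : ‖star (V a)‖ ≤ 1 := by
    rw [norm_star]
    exact (V a).opNorm_le_bound zero_le_one fun x => by rw [hV.norm_apply, one_mul]
  simpa using (star (V a)).le_of_opNorm_le h₁ h

variable [LinearOrder S] [CanonicallyOrderedAdd S] [IsCancelAdd S]

/-- The squared norms of the vectors `star (V a) h` decrease with `a`. -/
theorem IsIsometricRep.antitone_norm_star_apply {V : S → H →L[ℂ] H} (hV : IsIsometricRep V)
    (h : H) : Antitone fun a => ‖star (V a) h‖ ^ 2 := by
  intro a b hab
  obtain ⟨k, rfl⟩ := le_iff_exists_add.1 hab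
  refine pow_le_pow_left₀ (norm_nonneg _) ?_ 2
  rw [hV.map_add, star_mul]
  exact hV.norm_star_apply_le k _

/-- The standard basis of `ℓ²(S)`. -/
def delta (s : S) : lp (fun _ : S => ℂ) 2 := lp.single 2 s 1

theorem norm_delta (s : S) : ‖delta s‖ = 1 := by
  rw [delta, lp.norm_single (by norm_num), norm_one]

theorem inner_delta_left (s : S) (f : lp (fun _ : S => ℂ) 2) : ⟪delta s, f⟫_ℂ = f s := by
  rw [delta, lp.inner_single_left]
  simp

theorem inner_delta_delta (s r : S) : ⟪delta s, delta r⟫_ℂ = if s = r then 1 else 0 := by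
  rw [inner_delta_left, delta, lp.single_apply, Pi.single_apply]

theorem regularRep_delta (b c : S) : regularRep b (delta c) = delta (b + c) := by
  ext x
  by_cases hx : ∃ e, x = b + e
  · obtain ⟨e, rfl⟩ := hx
    rw [regularRep_apply_add]
    simp [delta, lp.single_apply, Pi.single_apply]
  · rw [regularRep_apply_of_notMem b x _ hx, delta, lp.single_apply, Pi.single_apply, if_neg]
    exact fun h => hx ⟨c, h⟩

theorem star_regularRep_delta_add (b c : S) :
    star (regularRep b) (delta (b + c)) = delta c := by
  rw [← regularRep_delta, ← mul_apply_eq_comp,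
    isIsometricRep_regularRep.isIsometricHom.star_mul_self, one_apply_eq_self]

theorem star_regularRep_delta_of_lt {b s : S} (h : s < b) :
    star (regularRep b) (delta s) = 0 := by
  refine ext_inner_right ℂ fun f => ?_
  rw [ContinuousLinearMap.star_eq_adjoint, ContinuousLinearMap.adjoint_inner_left,
    inner_delta_left, inner_zero_left, regularRep_apply_of_notMem]
  rintro ⟨c, rfl⟩
  exact h.not_ge le_self_add

/-- The adjoint shift sends `δ_r` to `δ_{r-a}` when `a ≤ r` and to `0` otherwise. Hence the diagonal
entry of a polynomial at `δ_r` is the partial sum of its diagonal coefficients up to `r`. -/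
theorem inner_star_regularRep_delta_self (a b r : S) :
    ⟪star (regularRep a) (delta r), star (regularRep b) (delta r)⟫_ℂ =
      if a = b then (if a ≤ r then 1 else 0) else 0 := by
  rcases lt_or_ge r a with h | h
  · simp [star_regularRep_delta_of_lt h, h.not_ge]
  rcases lt_or_ge r b with h' | h'
  · rw [star_regularRep_delta_of_lt h', inner_zero_right, if_neg]
    rintro rfl
    exact h'.not_ge h
  obtain ⟨c, rfl⟩ := le_iff_exists_add.1 h
  obtain ⟨e, he⟩ := le_iff_exists_add.1 h'
  rw [star_regularRep_delta_add, he, star_regularRep_delta_add, inner_delta_delta, ← he, if_pos h]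
  congr 1
  refine propext ⟨?_, ?_⟩
  · rintro rfl
    exact add_right_cancel he
  · rintro rfl
    exact add_left_cancel he

/-- Reindexes the diagonal part of a sum over pairs by `S` itself, the ordered index set that Abel
summation needs. -/
theorem sum_diagonal (l : S × S →₀ ℂ) (q : S → ℂ) :
    ∑ p ∈ l.support, l p * (if p.1 = p.2 then q p.1 else 0) =
      ∑ a ∈ (l.support.filter fun p => p.1 = p.2).image Prod.fst, l (a, a) * q a := by
  simp only [mul_ite, mul_zero]
  rw [← Finset.sum_filter, Finset.sum_image]
  · refine Finset.sum_congr rfl fun p hp => ?_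
    obtain ⟨a, b⟩ := p
    obtain rfl : a = b := (Finset.mem_filter.1 hp).2
    rfl
  · rintro ⟨a, b⟩ hp ⟨a', b'⟩ hp' h
    have h₁ : a = b := (Finset.mem_filter.1 hp).2
    have h₂ : a' = b' := (Finset.mem_filter.1 hp').2
    simp only at h
    rw [← h₁, ← h₂, h]

/-- The representation `V` twisted by all the characters of `ℤ × ℤ`, together with the regular
representation. -/
def twistedRep (d : S →+ ℤ × ℤ) (V : S → H →L[ℂ] H) (a : S) :
    (ℝ × ℝ → H →L[ℂ] H) × (lp (fun _ : S => ℂ) 2 →L[ℂ] lp (fun _ : S => ℂ) 2) :=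
  (fun θ => phase θ (d a) • V a, regularRep a)

variable {V : S → H →L[ℂ] H} {d : S →+ ℤ × ℤ}

theorem isIsometricHom_twistedRep (hV : IsIsometricRep V) :
    IsIsometricHom (twistedRep d V) where
  map_add a b := by
    refine Prod.ext (funext fun θ => ?_) (isIsometricRep_regularRep.map_add a b)
    change phase θ (d (a + b)) • V (a + b) = (phase θ (d a) • V a) * (phase θ (d b) • V b)
    rw [smul_mul_smul_comm, hV.map_add, map_add, phase_add]
  star_mul_self a := by
    refine Prod.ext (funext fun θ => ?_) (isIsometricRep_regularRep.isIsometricHom.star_mul_self a)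
    change star (phase θ (d a) • V a) * (phase θ (d a) • V a) = 1
    rw [star_smul, smul_mul_smul_comm, star_phase_mul_phase, hV.isIsometricHom.star_mul_self,
      one_smul]

theorem twistedRep_mul_star (a b : S) (θ : ℝ × ℝ) :
    (twistedRep d V a * star (twistedRep d V b)).1 θ =
      phase θ (d a - d b) • (V a * star (V b)) := by
  change (phase θ (d a) • V a) * star (phase θ (d b) • V b) = _
  rw [star_smul, smul_mul_smul_comm, star_phase, ← phase_add, sub_eq_add_neg]

theorem inner_mul_star_apply {E : Type*} [NormedAddCommGroup E] [InnerProductSpace ℂ E]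
    [CompleteSpace E] (T R : E →L[ℂ] E) (g h : E) :
    ⟪g, (T * star R) h⟫_ℂ = ⟪star T g, star R h⟫_ℂ := by
  rw [mul_apply_eq_comp, ContinuousLinearMap.star_eq_adjoint T,
    ContinuousLinearMap.adjoint_inner_left]

theorem inner_star_mul_self_apply {E : Type*} [NormedAddCommGroup E] [InnerProductSpace ℂ E]
    [CompleteSpace E] (T : E →L[ℂ] E) (h : E) : ⟪h, (star T * T) h⟫_ℂ = (‖T h‖ ^ 2 : ℝ) := by
  rw [mul_apply_eq_comp, ContinuousLinearMap.star_eq_adjoint T,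
    ContinuousLinearMap.adjoint_inner_right, inner_self_eq_norm_sq_to_K]
  norm_cast

/-- One coefficient family `l` expands `star z * z` in all twists and in the regular representation.
Summing over the sample characters isolates the diagonal coefficients, by injectivity of `d`; the
regular component controls their partial sums. -/
theorem norm_sq_apply_le_of_mem_monomialSpan (hd : Function.Injective d) (hV : IsIsometricRep V)
    {K : ℕ} {z : (ℝ × ℝ → H →L[ℂ] H) × (lp (fun _ : S => ℂ) 2 →L[ℂ] lp (fun _ : S => ℂ) 2)}
    (hz : star z * z ∈ monomialSpan d (twistedRep d V) K) (h : H) :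
    ‖z.1 0 h‖ ^ 2 ≤ (2 * K + 1) ^ 2 * (‖z.2‖ ^ 2 * ‖h‖ ^ 2) := by
  obtain ⟨l, hl, hy⟩ := exists_finsupp_of_mem_monomialSpan hz
  set s := (l.support.filter fun p => p.1 = p.2).image Prod.fst
  have hq : ∀ θ, ((‖z.1 θ h‖ ^ 2 : ℝ) : ℂ) = ∑ p ∈ l.support,
      l p * (phase θ (d p.1 - d p.2) * ⟪star (V p.1) h, star (V p.2) h⟫_ℂ) := by
    intro θ
    rw [← inner_star_mul_self_apply]
    have : star (z.1 θ) * z.1 θ = ∑ p ∈ l.support,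
        l p • (phase θ (d p.1 - d p.2) • (V p.1 * star (V p.2))) := by
      have := congrFun (congrArg Prod.fst hy) θ
      change star (z.1 θ) * z.1 θ = _ at this
      simpa only [Prod.fst_sum, Finset.sum_apply, Prod.smul_fst, Pi.smul_apply,
        twistedRep_mul_star] using this
    rw [this, sum_apply, inner_sum]
    refine Finset.sum_congr rfl fun p _ => ?_
    rw [smul_apply, smul_apply, inner_smul_right,
      inner_smul_right, inner_mul_star_apply]
  have hsum : ((∑ j ∈ Finset.range ((2 * K + 1) ^ 2), ‖z.1 (sampleAngle K j) h‖ ^ 2 : ℝ) : ℂ) =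
      (2 * K + 1) ^ 2 * ∑ a ∈ s, l (a, a) * (‖star (V a) h‖ ^ 2 : ℝ) := by
    rw [Complex.ofReal_sum]
    simp only [hq]
    rw [Finset.sum_comm, ← sum_diagonal l fun a => ((‖star (V a) h‖ ^ 2 : ℝ) : ℂ), Finset.mul_sum]
    refine Finset.sum_congr rfl fun p hp => ?_
    rw [← Finset.mul_sum, ← Finset.sum_mul, sum_phase_sampleAngle (hl p hp).1 (hl p hp).2]
    simp only [sub_eq_zero, hd.eq_iff]
    split_ifs with hp'
    · rw [← hp', inner_self_eq_norm_sq_to_K]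
      push_cast
      ring_nf
      rfl
    · ring
  have hpartial : ∀ r, ‖∑ a ∈ s with a ≤ r, l (a, a)‖ ≤ ‖z.2‖ ^ 2 := by
    intro r
    have h₁ : ∑ a ∈ s with a ≤ r, l (a, a) = ((‖z.2 (delta r)‖ ^ 2 : ℝ) : ℂ) := by
      rw [← inner_star_mul_self_apply]
      have : star z.2 * z.2 = ∑ p ∈ l.support,
          l p • (regularRep p.1 * star (regularRep p.2)) := by
        have := congrArg Prod.snd hy
        rw [Prod.snd_sum] at this
        exact this
      rw [this, sum_apply, inner_sum, Finset.sum_filter]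
      simp only [smul_apply, inner_smul_right, inner_mul_star_apply,
        inner_star_regularRep_delta_self]
      rw [sum_diagonal l fun a => if a ≤ r then 1 else 0]
      simp
      rfl
    rw [h₁, Complex.norm_real, Real.norm_of_nonneg (by positivity)]
    refine pow_le_pow_left₀ (norm_nonneg _) ?_ 2
    simpa [norm_delta] using z.2.le_opNorm (delta r)
  have habel := norm_sum_mul_le_of_partialSums (fun a => l (a, a)) (by positivity) s hpartial
    (by positivity) ((hV.antitone_norm_star_apply h).antitoneOn _) (fun _ _ => by positivity)
    fun a _ => pow_le_pow_left₀ (norm_nonneg _) (hV.norm_star_apply_le a h) 2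
  -- The untwisted representation is the term `j = 0`, and the other terms of the sum are
  -- nonnegative.
  have h₀ : z.1 0 = z.1 (sampleAngle K 0) := by simp [sampleAngle]; rfl
  calc ‖z.1 0 h‖ ^ 2 ≤ ∑ j ∈ Finset.range ((2 * K + 1) ^ 2), ‖z.1 (sampleAngle K j) h‖ ^ 2 := by
        rw [h₀]
        exact Finset.single_le_sum (f := fun j => ‖z.1 (sampleAngle K j) h‖ ^ 2)
          (fun _ _ => by positivity) (Finset.mem_range.2 (by positivity))
    _ = ‖((∑ j ∈ Finset.range ((2 * K + 1) ^ 2), ‖z.1 (sampleAngle K j) h‖ ^ 2 : ℝ) : ℂ)‖ := by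
        rw [Complex.norm_real, Real.norm_of_nonneg (Finset.sum_nonneg fun _ _ => by positivity)]
    _ ≤ _ := by
        rw [hsum, norm_mul]
        refine mul_le_mul (le_of_eq ?_) habel (norm_nonneg _) (by positivity)
        rw [norm_pow]
        norm_cast

/-- The degree bound of `star z * z` is `2 * K`, so the factor `2 * (2 * K) + 1` appears after
taking a square root. -/
theorem norm_le_of_mem_monomialSpan (hd : Function.Injective d) (hV : IsIsometricRep V)
    {K : ℕ} {z : (ℝ × ℝ → H →L[ℂ] H) × (lp (fun _ : S => ℂ) 2 →L[ℂ] lp (fun _ : S => ℂ) 2)}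
    (hz : z ∈ monomialSpan d (twistedRep d V) K) : ‖z.1 0‖ ≤ (4 * K + 1) * ‖z.2‖ := by
  refine ContinuousLinearMap.opNorm_le_bound _ (by positivity) fun h => ?_
  have hy := mul_mem_monomialSpan (isIsometricHom_twistedRep hV) (star_mem_monomialSpan hz) hz
  refine (pow_le_pow_iff_left₀ (norm_nonneg _) (by positivity) two_ne_zero).1 ?_
  refine (norm_sq_apply_le_of_mem_monomialSpan hd hV hy h).trans (le_of_eq ?_)
  push_cast
  ring

/-- The untwisted component of an element of the algebra of twisted representations. -/
def evalZero (H S : Type*) [NormedAddCommGroup H] [InnerProductSpace ℂ H] [CompleteSpace H] :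
    (ℝ × ℝ → H →L[ℂ] H) × (lp (fun _ : S => ℂ) 2 →L[ℂ] lp (fun _ : S => ℂ) 2) →⋆ₐ[ℂ]
      (H →L[ℂ] H) × (lp (fun _ : S => ℂ) 2 →L[ℂ] lp (fun _ : S => ℂ) 2) where
  toFun z := (z.1 0, z.2)
  map_one' := rfl
  map_mul' _ _ := rfl
  map_zero' := rfl
  map_add' _ _ := rfl
  commutes' _ := rfl
  map_star' _ := rfl

theorem evalZero_image_range :
    evalZero H S '' Set.range (twistedRep d V) = Set.range fun a => (V a, regularRep a) := by
  rw [← Set.range_comp]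
  congr 1
  funext a
  refine Prod.ext ?_ rfl
  change phase 0 (d a) • V a = V a
  rw [phase_zero_left, one_smul]

theorem norm_star_mul_self_pow {E : Type*} [NormedAddCommGroup E] [InnerProductSpace ℂ E]
    [CompleteSpace E] (T : E →L[ℂ] E) (n : ℕ) : ‖(star T * T) ^ 2 ^ n‖ = (‖T‖ ^ 2) ^ 2 ^ n := by
  rw [(IsSelfAdjoint.star_mul_self T).norm_pow_two_pow, CStarRing.norm_star_mul_self, sq]

/-- By the C*-identity, the norm of `(star T * T) ^ 2 ^ n` is exactly `(‖T‖ ^ 2) ^ 2 ^ n`. The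
degree bound of this power of `z` is `2 ^ n * (2 * K)`, so the crude estimate loses only `8 * K * 2
^ n + 1`, which is harmless after taking roots. -/
theorem norm_zero_le_of_mem_monomialSpan (hd : Function.Injective d) (hV : IsIsometricRep V)
    {K : ℕ} {z : (ℝ × ℝ → H →L[ℂ] H) × (lp (fun _ : S => ℂ) 2 →L[ℂ] lp (fun _ : S => ℂ) 2)}
    (hz : z ∈ monomialSpan d (twistedRep d V) K) : ‖z.1 0‖ ≤ ‖z.2‖ := by
  refine (pow_le_pow_iff_left₀ (norm_nonneg _) (norm_nonneg _) two_ne_zero).1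
    (le_of_pow_le_mul_pow (C := 8 * K) (by positivity) fun n => ?_)
  have hpow := pow_mem_monomialSpan (isIsometricHom_twistedRep hV)
    (mul_mem_monomialSpan (isIsometricHom_twistedRep hV) (star_mem_monomialSpan hz) hz) (2 ^ n)
  have h := norm_le_of_mem_monomialSpan hd hV hpow
  have h₁ : ((star z * z) ^ 2 ^ n).1 0 = (star (z.1 0) * z.1 0) ^ 2 ^ n := by
    rw [Prod.pow_fst, Pi.pow_apply]
    rfl
  have h₂ : ((star z * z) ^ 2 ^ n).2 = (star z.2 * z.2) ^ 2 ^ n := by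
    rw [Prod.pow_snd]
    rfl
  rw [h₁, h₂, norm_star_mul_self_pow, norm_star_mul_self_pow] at h
  refine h.trans (le_of_eq ?_)
  push_cast
  ring

/-- On polynomials, the norm of an isometric representation is at most that of the regular
representation. -/
theorem norm_fst_le_norm_snd (hd : Function.Injective d) (hV : IsIsometricRep V)
    {x : (H →L[ℂ] H) × (lp (fun _ : S => ℂ) 2 →L[ℂ] lp (fun _ : S => ℂ) 2)}
    (hx : x ∈ StarAlgebra.adjoin ℂ (Set.range fun a => (V a, regularRep a))) :
    ‖x.1‖ ≤ ‖x.2‖ := by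
  rw [← evalZero_image_range (d := d), ← StarAlgHom.map_adjoin] at hx
  obtain ⟨z, hz, rfl⟩ := hx
  obtain ⟨K, hK⟩ := exists_mem_monomialSpan d (isIsometricHom_twistedRep hV) hz
  exact norm_zero_le_of_mem_monomialSpan hd hV hK

end Comparison

/-! ### Lower bound: wandering vectors imitate the standard basis -/

section LowerBound

variable {S : Type*} [AddCommMonoid S] [LinearOrder S] [CanonicallyOrderedAdd S] [IsCancelAdd S]
  {H : Type*} [NormedAddCommGroup H] [InnerProductSpace ℂ H] [CompleteSpace H]
  {V : S → H →L[ℂ] H}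

theorem isIsometricHom_pair (hV : IsIsometricRep V) :
    IsIsometricHom fun a => (V a, (regularRep a : lp (fun _ : S => ℂ) 2 →L[ℂ] _)) where
  map_add a b := Prod.ext (hV.map_add a b) (isIsometricRep_regularRep.map_add a b)
  star_mul_self a := Prod.ext (hV.isIsometricHom.star_mul_self a)
    (isIsometricRep_regularRep.isIsometricHom.star_mul_self a)

theorem IsIsometricRep.star_apply_add (hV : IsIsometricRep V) (b c : S) (f : H) :
    star (V b) (V (b + c) f) = V c f := by
  rw [← mul_apply_eq_comp, hV.isIsometricHom.star_mul_add]

theorem IsIsometricRep.star_add_apply (hV : IsIsometricRep V) (b c : S) (f : H) :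
    star (V (b + c)) (V b f) = star (V c) f := by
  rw [← mul_apply_eq_comp, hV.isIsometricHom.star_add_mul]

theorem inner_apply_of_star_apply_eq_zero {T : H →L[ℂ] H} {f : H} (hf : star T f = 0) :
    ⟪f, T f⟫_ℂ = 0 := by
  rw [← ContinuousLinearMap.adjoint_inner_left, ← ContinuousLinearMap.star_eq_adjoint, hf,
    inner_zero_left]

theorem IsIsometricRep.inner_apply_apply (hV : IsIsometricRep V) (a : S) (f g : H) :
    ⟪V a f, V a g⟫_ℂ = ⟪f, g⟫_ℂ := by
  rw [← ContinuousLinearMap.adjoint_inner_right, ← ContinuousLinearMap.star_eq_adjoint,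
    ← mul_apply_eq_comp, hV.isIsometricHom.star_mul_self, one_apply_eq_self]

/-- The matrix entries of a polynomial in `V` with respect to the translates of a vector `f` that
is orthogonal to sufficiently many ranges agree with those for the regular representation. -/
theorem exists_finset_inner_eq (hV : IsIsometricRep V) (d : S →+ ℤ × ℤ)
    {x : (H →L[ℂ] H) × (lp (fun _ : S => ℂ) 2 →L[ℂ] lp (fun _ : S => ℂ) 2)}
    (hx : x ∈ StarAlgebra.adjoin ℂ (Set.range fun a => (V a, regularRep a))) (r s : S) :
    ∃ E : Finset S, (∀ e ∈ E, e ≠ 0) ∧ ∀ f : H, ‖f‖ = 1 → (∀ e ∈ E, star (V e) f = 0) →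
      ⟪V r f, x.1 (V s f)⟫_ℂ = ⟪delta r, x.2 (delta s)⟫_ℂ := by
  obtain ⟨K, hK⟩ := exists_mem_monomialSpan d (isIsometricHom_pair hV) hx
  clear hx
  induction hK using Submodule.span_induction with
  | zero => exact ⟨∅, by simp, fun f _ _ => by simp⟩
  | add x y _ _ hx hy =>
    obtain ⟨E, hE, h⟩ := hx
    obtain ⟨E', hE', h'⟩ := hy
    refine ⟨E ∪ E', fun e he => (Finset.mem_union.1 he).elim (hE e) (hE' e), fun f hf hf' => ?_⟩
    rw [Prod.fst_add, Prod.snd_add, add_apply, add_apply, inner_add_right, inner_add_right,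
      h f hf fun e he => hf' e (Finset.mem_union_left _ he),
      h' f hf fun e he => hf' e (Finset.mem_union_right _ he)]
  | smul c x _ hx =>
    obtain ⟨E, hE, h⟩ := hx
    refine ⟨E, hE, fun f hf hf' => ?_⟩
    rw [Prod.smul_fst, Prod.smul_snd, smul_apply, smul_apply, inner_smul_right, inner_smul_right,
      h f hf hf']
  | mem x h =>
    obtain ⟨⟨a, b⟩, -, rfl⟩ := h
    have key : ∀ f : H, (⟪star (V a) (V r f), star (V b) (V s f)⟫_ℂ =
        ⟪star (regularRep a) (delta r), star (regularRep b) (delta s)⟫_ℂ) →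
        ⟪V r f, (V a * star (V b)) (V s f)⟫_ℂ =
          ⟪delta r, (regularRep a * star (regularRep b)) (delta s)⟫_ℂ := fun f h => by
      rw [inner_mul_star_apply, inner_mul_star_apply, h]
    suffices ∃ E : Finset S, (∀ e ∈ E, e ≠ 0) ∧ ∀ f : H, ‖f‖ = 1 → (∀ e ∈ E, star (V e) f = 0) →
        ⟪star (V a) (V r f), star (V b) (V s f)⟫_ℂ =
        ⟪star (regularRep a) (delta r), star (regularRep b) (delta s)⟫_ℂ by
      obtain ⟨E, hE, h⟩ := this
      exact ⟨E, hE, fun f hf hf' => key f (h f hf hf')⟩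
    -- For `b = s + k`, `star (V b) (V s f) = star (V k) f`, so killing `f` by `star (V k)`
    -- reproduces the regular value `0`. The case `r < a` is symmetric.
    rcases lt_or_ge s b with h | h
    · obtain ⟨k, rfl⟩ := le_iff_exists_add.1 h.le
      refine ⟨{k}, by rintro e he rfl; simp [← Finset.mem_singleton.1 he] at h, fun f _ hf => ?_⟩
      rw [hV.star_add_apply, hf k (Finset.mem_singleton_self k), star_regularRep_delta_of_lt h,
        inner_zero_right, inner_zero_right]
    rcases lt_or_ge r a with h' | h'
    · obtain ⟨k, rfl⟩ := le_iff_exists_add.1 h'.le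
      refine ⟨{k}, by rintro e he rfl; simp [← Finset.mem_singleton.1 he] at h', fun f _ hf => ?_⟩
      rw [hV.star_add_apply, hf k (Finset.mem_singleton_self k), star_regularRep_delta_of_lt h',
        inner_zero_left, inner_zero_left]
    obtain ⟨c, rfl⟩ := le_iff_exists_add.1 h
    obtain ⟨e, rfl⟩ := le_iff_exists_add.1 h'
    simp only [hV.star_apply_add, star_regularRep_delta_add, inner_delta_delta]
    -- What remains is `⟪V e f, V c f⟫`. Cancelling the smaller index leaves `⟪f, V k f⟫` or its
    -- conjugate, which vanishes if `star (V k) f = 0`.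
    rcases lt_trichotomy e c with hec | rfl | hec
    · obtain ⟨k, rfl⟩ := le_iff_exists_add.1 hec.le
      refine ⟨{k}, by rintro e' he rfl; simp [← Finset.mem_singleton.1 he] at hec,
        fun f _ hf => ?_⟩
      rw [if_neg hec.ne, hV.map_add, mul_apply_eq_comp, hV.inner_apply_apply,
        inner_apply_of_star_apply_eq_zero (hf k (Finset.mem_singleton_self k))]
    · refine ⟨∅, by simp, fun f hf _ => ?_⟩
      rw [hV.inner_apply_apply, if_pos rfl, inner_self_eq_norm_sq_to_K, hf]
      simp
    · obtain ⟨k, rfl⟩ := le_iff_exists_add.1 hec.le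
      refine ⟨{k}, by rintro e' he rfl; simp [← Finset.mem_singleton.1 he] at hec,
        fun f _ hf => ?_⟩
      rw [if_neg hec.ne', hV.map_add, mul_apply_eq_comp, hV.inner_apply_apply,
        ← inner_conj_symm, inner_apply_of_star_apply_eq_zero (hf k (Finset.mem_singleton_self k)),
        _root_.map_zero]

/-- For `h` outside the range of `V a`, the component `h - V a (star (V a) h)` orthogonal to that
range is nonzero; normalise it. -/
theorem exists_norm_eq_one_star_apply_eq_zero (hV : IsIsometricRep V) {a : S}
    (ha : ¬ Function.Surjective (V a)) : ∃ f : H, ‖f‖ = 1 ∧ star (V a) f = 0 := by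
  simp only [Function.Surjective, not_forall, not_exists] at ha
  obtain ⟨h, hh⟩ := ha
  have hne : h - V a (star (V a) h) ≠ 0 := fun h₀ => hh _ (sub_eq_zero.1 h₀).symm
  refine ⟨((‖h - V a (star (V a) h)‖⁻¹ : ℝ) : ℂ) • (h - V a (star (V a) h)), ?_, ?_⟩
  · rw [norm_smul, Complex.norm_real, norm_inv, norm_norm, inv_mul_cancel₀ (norm_ne_zero_iff.2 hne)]
  · rw [map_smul, map_sub, ← mul_apply_eq_comp (star (V a)), hV.isIsometricHom.star_mul_self, one_apply_eq_self,
      sub_self, smul_zero]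

theorem inner_sum_smul_apply_sum_smul {ι E : Type*} [NormedAddCommGroup E] [InnerProductSpace ℂ E]
    (F : Finset ι) (c : ι → ℂ) (v : ι → E) (T : E →L[ℂ] E) :
    ⟪∑ s ∈ F, c s • v s, T (∑ s ∈ F, c s • v s)⟫_ℂ =
      ∑ r ∈ F, ∑ s ∈ F, conj (c r) * (c s * ⟪v r, T (v s)⟫_ℂ) := by
  rw [sum_inner]
  refine Finset.sum_congr rfl fun r _ => ?_
  rw [map_sum, inner_sum]
  refine Finset.sum_congr rfl fun s _ => ?_
  rw [inner_smul_left, map_smul, inner_smul_right]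

/-- On polynomials, the norm of the regular representation is at most that of an isometric
representation without unitaries. -/
theorem norm_snd_le_norm_fst [Nontrivial S] (d : S →+ ℤ × ℤ) (hV : IsIsometricRep V)
    (hV' : ∀ a, a ≠ 0 → ¬ Function.Surjective (V a))
    {x : (H →L[ℂ] H) × (lp (fun _ : S => ℂ) 2 →L[ℂ] lp (fun _ : S => ℂ) 2)}
    (hx : x ∈ StarAlgebra.adjoin ℂ (Set.range fun a => (V a, regularRep a))) :
    ‖x.2‖ ≤ ‖x.1‖ := by
  have hfin : ∀ (F : Finset S) (c : S → ℂ),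
      ‖x.2 (∑ s ∈ F, c s • delta s)‖ ≤ ‖x.1‖ * ‖∑ s ∈ F, c s • delta s‖ := by
    intro F c
    -- Entries of `star x * x` give `‖x.1 u‖ = ‖x.2 ξ‖`; those of `1`, chosen next, give `‖u‖ =
    -- ‖ξ‖`.
    choose E hE hE' using fun r s => exists_finset_inner_eq hV d (mul_mem (star_mem hx) hx) r s
    choose E₁ hE₁ hE₁' using fun r s => exists_finset_inner_eq hV d
      (one_mem (StarAlgebra.adjoin ℂ (Set.range fun a => (V a, regularRep a)))) r s
    obtain ⟨ε, hε⟩ := exists_ne (0 : S)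
    -- The extra `ε` only keeps `D` nonempty. A vector killed at the least element of `D` is killed
    -- at all of `D`.
    set D : Finset S := insert ε (F.biUnion fun r => F.biUnion fun s => E r s ∪ E₁ r s) with hD
    have hD₀ : ∀ e ∈ D, e ≠ 0 := by
      intro e he
      rw [hD, Finset.mem_insert] at he
      rcases he with rfl | he
      · exact hε
      · simp only [Finset.mem_biUnion, Finset.mem_union] at he
        obtain ⟨r, -, s, -, he | he⟩ := he
        exacts [hE r s e he, hE₁ r s e he]
    have hne : D.Nonempty := Finset.insert_nonempty _ _
    obtain ⟨f, hf, hf'⟩ := exists_norm_eq_one_star_apply_eq_zero hV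
      (hV' _ (hD₀ _ (D.min'_mem hne)))
    have hf'' : ∀ e ∈ D, star (V e) f = 0 := by
      intro e he
      obtain ⟨k, hk⟩ := le_iff_exists_add.1 (D.min'_le e he)
      rw [hk, hV.map_add, star_mul, mul_apply_eq_comp, hf', _root_.map_zero]
    have hmem : ∀ r ∈ F, ∀ s ∈ F, ∀ e, e ∈ E r s ∨ e ∈ E₁ r s → e ∈ D := by
      intro r hr s hs e he
      refine Finset.mem_insert_of_mem ?_
      simp only [Finset.mem_biUnion, Finset.mem_union]
      exact ⟨r, hr, s, hs, he⟩
    set u := ∑ s ∈ F, c s • V s f with hu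
    set ξ : lp (fun _ : S => ℂ) 2 := ∑ s ∈ F, c s • delta s with hξ
    have h₁ : ⟪u, (star x.1 * x.1) u⟫_ℂ = ⟪ξ, (star x.2 * x.2) ξ⟫_ℂ := by
      rw [hu, hξ, inner_sum_smul_apply_sum_smul, inner_sum_smul_apply_sum_smul]
      refine Finset.sum_congr rfl fun r hr => Finset.sum_congr rfl fun s hs => ?_
      congr 2
      exact hE' r s f hf fun e he => hf'' e (hmem r hr s hs e (Or.inl he))
    have h₂ : ⟪u, (1 : H →L[ℂ] H) u⟫_ℂ =
        ⟪ξ, (1 : lp (fun _ : S => ℂ) 2 →L[ℂ] lp (fun _ : S => ℂ) 2) ξ⟫_ℂ := by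
      rw [hu, hξ, inner_sum_smul_apply_sum_smul, inner_sum_smul_apply_sum_smul]
      refine Finset.sum_congr rfl fun r hr => Finset.sum_congr rfl fun s hs => ?_
      congr 2
      exact hE₁' r s f hf fun e he => hf'' e (hmem r hr s hs e (Or.inr he))
    have h₃ : ‖x.1 u‖ = ‖x.2 ξ‖ := by
      rw [inner_star_mul_self_apply, inner_star_mul_self_apply, Complex.ofReal_inj] at h₁
      exact (pow_left_inj₀ (norm_nonneg _) (norm_nonneg _) two_ne_zero).1 h₁
    have h₄ : ‖u‖ = ‖ξ‖ := by
      rw [one_apply_eq_self, one_apply_eq_self, inner_self_eq_norm_sq_to_K,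
        inner_self_eq_norm_sq_to_K] at h₂
      refine (pow_left_inj₀ (norm_nonneg _) (norm_nonneg _) two_ne_zero).1 ?_
      exact_mod_cast h₂
    rw [← h₃, ← h₄]
    exact x.1.le_opNorm u
  refine ContinuousLinearMap.opNorm_le_bound _ (norm_nonneg _) fun f => ?_
  have hlim : Filter.Tendsto (fun F : Finset S => ∑ s ∈ F, f s • delta s) Filter.atTop (nhds f) := by
    have := lp.hasSum_single (p := 2) (by norm_num) f
    simpa [HasSum, delta, ← lp.single_smul] using this
  exact le_of_tendsto_of_tendsto' ((x.2.continuous.tendsto f).comp hlim).norm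
    (hlim.norm.const_mul _) fun F => hfin F _

end LowerBound

/-! ### Extension to the generated C*-algebras -/

section Extension

/-- A continuous star homomorphism that preserves the norm on the star algebra generated by `s`
restricts to a star isomorphism of the C*-algebras generated by `s` and by its image. -/
theorem exists_starAlgEquiv_topologicalClosure {A B : Type*}
    [NormedRing A] [StarRing A] [NormedAlgebra ℂ A] [StarModule ℂ A] [ContinuousStar A]
    [CompleteSpace A] [NormedRing B] [StarRing B] [NormedAlgebra ℂ B] [StarModule ℂ B]
    [ContinuousStar B] (f : A →⋆ₐ[ℂ] B) (hf : Continuous f) (s : Set A)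
    (hnorm : ∀ x ∈ StarAlgebra.adjoin ℂ s, ‖f x‖ = ‖x‖) {s' : Set B} (hs : f '' s = s') :
    ∃ e : (StarAlgebra.adjoin ℂ s).topologicalClosure ≃⋆ₐ[ℂ]
      (StarAlgebra.adjoin ℂ s').topologicalClosure, ∀ x, (e x : B) = f x := by
  set J := (StarAlgebra.adjoin ℂ s).topologicalClosure with hJ
  have hnorm' : ∀ x ∈ J, ‖f x‖ = ‖x‖ := by
    intro x hx
    exact closure_minimal (t := {x | ‖f x‖ = ‖x‖}) hnorm
      (isClosed_eq hf.norm continuous_norm) hx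
  have hmem : ∀ x : J, f x ∈ (StarAlgebra.adjoin ℂ s').topologicalClosure := by
    intro x
    have h₁ : f '' (StarAlgebra.adjoin ℂ s : Set A) ⊆ StarAlgebra.adjoin ℂ s' := by
      rw [← hs, ← StarAlgHom.map_adjoin]
      exact subset_rfl
    exact closure_mono h₁ (image_closure_subset_closure_image hf ⟨x, x.2, rfl⟩)
  let g : J →⋆ₐ[ℂ] (StarAlgebra.adjoin ℂ s').topologicalClosure :=
    (f.comp J.subtype).codRestrict _ hmem
  have hisom : Isometry (f.comp J.subtype) :=
    (AddMonoidHomClass.isometry_iff_norm (f.comp J.subtype)).2 fun x => hnorm' x x.2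
  have hcomplete : CompleteSpace J :=
    (StarSubalgebra.isClosed_topologicalClosure _).completeSpace_coe
  -- An isometry from a complete space has closed range, so surjectivity need only be checked on
  -- generators.
  have hle : (StarAlgebra.adjoin ℂ s').topologicalClosure ≤ (f.comp J.subtype).range := by
    refine StarSubalgebra.topologicalClosure_minimal ?_ hisom.isClosedEmbedding.isClosed_range
    rw [StarAlgebra.adjoin_le_iff, ← hs]
    rintro _ ⟨x, hx, rfl⟩
    exact ⟨⟨x, StarSubalgebra.le_topologicalClosure _ (StarAlgebra.subset_adjoin ℂ s hx)⟩, rfl⟩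
  refine ⟨StarAlgEquiv.ofBijective g ⟨fun x y h => hisom.injective (congrArg Subtype.val h),
    fun y => ?_⟩, fun x => rfl⟩
  obtain ⟨x, hx⟩ := hle y.2
  exact ⟨x, Subtype.ext hx⟩

/-- The C*-algebra generated by the pairs `(π₁ a, π₂ a)` serves as the graph of `τ`. The product
norm is a maximum of two equal norms, so both projections are isometric, and `τ` is the second after
the inverse of the first. -/
theorem canonicallyIsomorphic_of_norm_eq {S H₁ H₂ : Type*}
    [NormedAddCommGroup H₁] [InnerProductSpace ℂ H₁] [CompleteSpace H₁]
    [NormedAddCommGroup H₂] [InnerProductSpace ℂ H₂] [CompleteSpace H₂]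
    {π₁ : S → H₁ →L[ℂ] H₁} {π₂ : S → H₂ →L[ℂ] H₂}
    (h : ∀ x ∈ StarAlgebra.adjoin ℂ (Set.range fun a => (π₁ a, π₂ a)), ‖x.1‖ = ‖x.2‖) :
    CanonicallyIsomorphic π₁ π₂ := by
  obtain ⟨e₁, he₁⟩ := exists_starAlgEquiv_topologicalClosure
    (StarAlgHom.fst ℂ (H₁ →L[ℂ] H₁) (H₂ →L[ℂ] H₂)) continuous_fst
    (Set.range fun a => (π₁ a, π₂ a))
    (fun x hx => by rw [Prod.norm_def, ← h x hx, max_self]; rfl)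
    (s' := Set.range π₁) (by rw [← Set.range_comp]; rfl)
  obtain ⟨e₂, he₂⟩ := exists_starAlgEquiv_topologicalClosure
    (StarAlgHom.snd ℂ (H₁ →L[ℂ] H₁) (H₂ →L[ℂ] H₂)) continuous_snd
    (Set.range fun a => (π₁ a, π₂ a))
    (fun x hx => by rw [Prod.norm_def, h x hx, max_self]; rfl)
    (s' := Set.range π₂) (by rw [← Set.range_comp]; rfl)
  refine ⟨e₁.symm.trans e₂, fun a => Subtype.ext ?_⟩
  let p : (StarAlgebra.adjoin ℂ (Set.range fun a => (π₁ a, π₂ a))).topologicalClosure :=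
    ⟨(π₁ a, π₂ a), StarSubalgebra.le_topologicalClosure _
      (StarAlgebra.subset_adjoin ℂ _ (Set.mem_range_self a))⟩
  have hp : toCstarRep π₁ a = e₁ p := Subtype.ext (he₁ p).symm
  rw [hp]
  change ((e₂ (e₁.symm (e₁ p)) : cstarRep π₂) : H₂ →L[ℂ] H₂) = π₂ a
  rw [e₁.symm_apply_apply]
  exact he₂ p

/-- An isometric representation without unitaries of a totally ordered cone of rank at most two
generates the reduced C*-algebra of the cone. -/
theorem canonicallyIsomorphic_regularRep {S H : Type*} [AddCommMonoid S] [LinearOrder S]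
    [CanonicallyOrderedAdd S] [IsCancelAdd S] [Nontrivial S]
    [NormedAddCommGroup H] [InnerProductSpace ℂ H] [CompleteSpace H] {V : S → H →L[ℂ] H}
    {d : S →+ ℤ × ℤ} (hd : Function.Injective d) (hV : IsIsometricRep V)
    (hV' : ∀ a, a ≠ 0 → ¬ Function.Surjective (V a)) :
    CanonicallyIsomorphic V (regularRep (S := S)) :=
  canonicallyIsomorphic_of_norm_eq fun _ hx =>
    (norm_fst_le_norm_snd hd hV hx).antisymm (norm_snd_le_norm_fst d hV hV' hx)

end Extension

/-! ### The Hardy space -/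

theorem isClosed_hardy : IsClosed (hardy : Set (Lp ℂ 2 arcMeasure)) :=
  Submodule.isClosed_topologicalClosure _

theorem fourierLp_mem_hardy (n : ℕ) : fourierLp (T := 2 * Real.pi) 2 (n : ℤ) ∈ hardy :=
  Submodule.le_topologicalClosure _ (Submodule.subset_span ⟨n, rfl⟩)

theorem fourier_natCast_apply (n : ℕ) (θ : Angle) :
    (fourier (n : ℤ) θ : ℂ) = (fourier 1 θ) ^ n := by
  induction n with
  | zero => simp
  | succ n ih => rw [Nat.cast_succ, fourier_add, ih, pow_succ]

theorem norm_fourier_apply (n : ℤ) (θ : Angle) : ‖(fourier n θ : ℂ)‖ = 1 := by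
  rw [fourier_apply]
  exact Circle.norm_coe _

/-- A function with an absolutely convergent Fourier series without negative frequencies is in
the Hardy space. -/
theorem mem_hardy_of_hasSum {c : ℕ → ℂ} (hc : Summable fun n => ‖c n‖) {u : Lp ℂ 2 arcMeasure}
    (hu : ∀ᵐ θ ∂arcMeasure, HasSum (fun n => c n * (fourier 1 θ) ^ n) (u θ)) : u ∈ hardy := by
  have hsum : Summable fun n : ℕ => c n • (fourier (n : ℤ) : C(Angle, ℂ)) := by
    refine Summable.of_norm ?_
    simpa only [norm_smul, fourier_norm, mul_one] using hc
  set g : C(Angle, ℂ) := ∑' n : ℕ, c n • (fourier (n : ℤ) : C(Angle, ℂ)) with hg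
  have hug : u = ContinuousMap.toLp (E := ℂ) 2 arcMeasure ℂ g := by
    refine Lp.ext ?_
    filter_upwards [hu, ContinuousMap.coeFn_toLp (p := 2) (𝕜 := ℂ) arcMeasure g] with θ h₁ h₂
    rw [h₂]
    refine h₁.unique ?_
    have := ContinuousMap.hasSum_apply hsum.hasSum θ
    simpa only [ContinuousMap.smul_apply, smul_eq_mul, fourier_natCast_apply] using this
  rw [hug]
  have h := (ContinuousMap.toLp (E := ℂ) 2 arcMeasure ℂ).hasSum hsum.hasSum
  refine isClosed_hardy.mem_of_tendsto h (.of_forall fun s => sum_mem fun n _ => ?_)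
  simp only [map_smul]
  exact Submodule.smul_mem _ _ (fourierLp_mem_hardy n)

/-- The restriction to a circle of radius less than `1` of a holomorphic function on the unit disc
is in the Hardy space. -/
theorem mem_hardy_of_differentiableOn {F : ℂ → ℂ} (hF : DifferentiableOn ℂ F (Metric.ball 0 1))
    {r : ℝ} (hr₀ : 0 ≤ r) (hr₁ : r < 1) {u : Lp ℂ 2 arcMeasure}
    (hu : u =ᵐ[arcMeasure] fun θ => F (r * fourier 1 θ)) : u ∈ hardy := by
  -- The Cauchy series on the disc of radius `R > r` converges absolutely at radius `r`.
  obtain ⟨R, hrR, hR⟩ := exists_between hr₁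
  lift r to NNReal using hr₀
  lift R to NNReal using r.2.trans hrR.le
  have hR₀ : 0 < R := lt_of_le_of_lt r.2 hrR
  have hps := (hF.mono (Metric.closedBall_subset_ball hR)).hasFPowerSeriesOnBall hR₀
  set p := cauchyPowerSeries F 0 R
  have hrad : (r : ℝ≥0∞) < p.radius := lt_of_lt_of_le (by exact_mod_cast hrR) hps.r_le
  have hmem : ∀ θ : Angle, (r : ℂ) * fourier 1 θ ∈ Metric.eball (0 : ℂ) R := by
    intro θ
    rw [Metric.mem_eball, edist_zero_right, ← ofReal_norm, norm_mul, norm_fourier_apply]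
    simpa using hrR
  refine mem_hardy_of_hasSum (c := fun n => p.coeff n * r ^ n) ?_ ?_
  · have := p.summable_norm_mul_pow hrad
    simpa only [norm_mul, norm_pow, FormalMultilinearSeries.coeff, Complex.norm_real,
      FormalMultilinearSeries.norm_apply_eq_norm_coef, NNReal.norm_eq] using this
  · filter_upwards [hu] with θ hθ
    rw [hθ]
    have := hps.hasSum (hmem θ)
    simp only [FormalMultilinearSeries.apply_eq_pow_smul_coeff, zero_add, smul_eq_mul] at this
    refine this.congr_fun fun n => ?_
    ring

/-- The Hardy space is closed under bounded pointwise limits. -/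
theorem mem_hardy_of_tendsto {f : Lp ℂ 2 arcMeasure} {u : ℕ → Lp ℂ 2 arcMeasure}
    (hu : ∀ k, u k ∈ hardy) {C : ℝ} (hC : ∀ k, ∀ᵐ θ ∂arcMeasure, ‖u k θ‖ ≤ C)
    (hlim : ∀ᵐ θ ∂arcMeasure, Filter.Tendsto (fun k => u k θ) Filter.atTop (nhds (f θ))) :
    f ∈ hardy := by
  -- Weak convergence suffices: each inner product with `g` passes to the limit by domination with
  -- `‖g‖ * C`.
  rw [← Submodule.orthogonal_orthogonal hardy, Submodule.mem_orthogonal]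
  intro g hg
  have hzero : ∀ k, ⟪g, u k⟫_ℂ = 0 := fun k => by
    rw [← inner_conj_symm, hg _ (hu k), map_zero]
  have htend : Filter.Tendsto (fun k => ⟪g, u k⟫_ℂ) Filter.atTop (nhds ⟪g, f⟫_ℂ) := by
    simp only [L2.inner_def]
    refine tendsto_integral_of_dominated_convergence (fun θ => ‖g θ‖ * C)
      (fun k => ((Lp.aestronglyMeasurable g).inner (Lp.aestronglyMeasurable (u k)))) ?_
      (fun k => ?_) ?_
    · exact (((Lp.memLp g).integrable (by norm_num)).norm).mul_const C
    · filter_upwards [hC k] with θ hθ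
      exact (norm_inner_le_norm _ _).trans (mul_le_mul_of_nonneg_left hθ (norm_nonneg _))
    · filter_upwards [hlim] with θ hθ
      exact tendsto_const_nhds.inner hθ
  simp only [hzero] at htend
  exact tendsto_nhds_unique htend tendsto_const_nhds |>.symm ▸ rfl

/-! ### The singular inner functions -/

theorem fourier_one_eq_one_iff (θ : Angle) : (fourier 1 θ : ℂ) = 1 ↔ θ = 0 := by
  rw [fourier_one, Circle.coe_eq_one, ← AddCircle.toCircle_zero]
  exact (AddCircle.injective_toCircle Real.two_pi_pos.ne').eq_iff

/-- Removes the one point where the exponent of `Φ_s` is singular. -/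
theorem ae_ne_zero : ∀ᵐ θ : Angle ∂arcMeasure, θ ≠ 0 := by
  rw [ae_iff]
  simp only [ne_eq, not_not, Set.ofPred_eq_eq_singleton]
  have h : (volume : Measure Angle) {0} = 0 := by
    have := AddCircle.volume_closedBall (T := 2 * Real.pi) (x := 0) 0
    simpa using this
  rw [AddCircle.volume_eq_smul_haarAddCircle, Measure.smul_apply, smul_eq_mul, mul_eq_zero] at h
  exact h.resolve_left (ENNReal.ofReal_pos.2 Real.two_pi_pos).ne'

/-- The real part of `(w + 1) / (w - 1)` is `(|w|² - 1) / |w - 1|²`, which is negative on the disc.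
-/
theorem norm_exp_singular_le_one {s : ℝ} (hs : 0 ≤ s) {w : ℂ} (hw : ‖w‖ < 1) :
    ‖Complex.exp (s * ((w + 1) / (w - 1)))‖ ≤ 1 := by
  rw [Complex.norm_exp, Real.exp_le_one_iff, Complex.re_ofReal_mul]
  refine mul_nonpos_of_nonneg_of_nonpos hs ?_
  have h : w.re * w.re + w.im * w.im ≤ 1 := by
    rw [← Complex.normSq_apply, Complex.normSq_eq_norm_sq]
    exact pow_le_one₀ (norm_nonneg _) hw.le
  rw [Complex.div_re, ← add_div]
  refine div_nonpos_of_nonpos_of_nonneg ?_ (Complex.normSq_nonneg _)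
  simp only [Complex.add_re, Complex.sub_re, Complex.add_im, Complex.sub_im, Complex.one_re,
    Complex.one_im]
  linarith

theorem mulOp_singularInner_ae (s : ℝ) (f : Lp ℂ 2 arcMeasure) :
    mulOp (memLp_singularInner s).toLp f =ᵐ[arcMeasure] fun θ => singularInner s θ * f θ := by
  have h := ContinuousLinearMap.coeFn_holder (r := 2) (ContinuousLinearMap.mul ℂ ℂ)
    ((memLp_singularInner s).toLp) f
  filter_upwards [h, (memLp_singularInner s).coeFn_toLp] with θ h₁ h₂
  rw [mulOp, ContinuousLinearMap.holderL_apply_apply, h₁, h₂]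
  rfl

theorem continuousAt_exp_singular (s : ℝ) {w : ℂ} (hw : w ≠ 1) :
    ContinuousAt (fun w : ℂ => Complex.exp (s * ((w + 1) / (w - 1)))) w := by
  have : w - 1 ≠ 0 := sub_ne_zero.2 hw
  fun_prop (disch := assumption)

/-- `Φ_s e^{inθ}` is the almost everywhere radial limit of the holomorphic function `F`, which is
bounded by `1` on the disc. Its dilations with `r k → 1` lie in `H²`. -/
theorem mulOp_singularInner_fourierLp_mem_hardy {s : ℝ} (hs : 0 ≤ s) (n : ℕ) :
    mulOp (memLp_singularInner s).toLp (fourierLp 2 (n : ℤ)) ∈ hardy := by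
  set F : ℂ → ℂ := fun w => Complex.exp (s * ((w + 1) / (w - 1))) * w ^ n with hF
  have hFd : DifferentiableOn ℂ F (Metric.ball 0 1) := by
    intro w hw
    have hw1 : w - 1 ≠ 0 := by
      rw [sub_ne_zero]
      rintro rfl
      simp at hw
    refine DifferentiableAt.differentiableWithinAt ?_
    simp only [hF]
    fun_prop (disch := assumption)
  have hFc : ∀ w : ℂ, w ≠ 1 → ContinuousAt F w := fun w hw =>
    (continuousAt_exp_singular s hw).mul (continuousAt_id.pow n)
  let r : ℕ → ℝ := fun k => 1 - 1 / ((k : ℝ) + 1)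
  have hr₀ : ∀ k, 0 ≤ r k := fun k => by
    simp only [r, sub_nonneg]
    exact (div_le_one (by positivity)).2 (by linarith [k.cast_nonneg (α := ℝ)])
  have hr₁ : ∀ k, r k < 1 := fun k => by
    simp only [r]
    linarith [one_div_pos.2 (k.cast_add_one_pos (α := ℝ))]
  have hr : Filter.Tendsto r Filter.atTop (nhds 1) := by
    simpa only [sub_zero] using tendsto_one_div_add_atTop_nhds_zero_nat.const_sub (1 : ℝ)
  have hnorm : ∀ k (θ : Angle), ‖(r k : ℂ) * fourier 1 θ‖ < 1 := fun k θ => by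
    rw [norm_mul, norm_fourier_apply, mul_one, Complex.norm_real, Real.norm_of_nonneg (hr₀ k)]
    exact hr₁ k
  have hbound : ∀ k (θ : Angle), ‖F (r k * fourier 1 θ)‖ ≤ 1 := fun k θ => by
    rw [hF, norm_mul, norm_pow]
    exact mul_le_one₀ (norm_exp_singular_le_one hs (hnorm k θ)) (by positivity)
      (pow_le_one₀ (norm_nonneg _) (hnorm k θ).le)
  have hcont : ∀ k, Continuous fun θ : Angle => F (r k * fourier 1 θ) := fun k => by
    refine continuous_iff_continuousAt.2 fun θ => ContinuousAt.comp (g := F) (hFc _ ?_) ?_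
    · intro h
      have := hnorm k θ
      rw [h, norm_one] at this
      exact this.false
    · exact (continuous_const.mul (fourier 1).continuous).continuousAt
  have hmem : ∀ k, MemLp (fun θ : Angle => F (r k * fourier 1 θ)) 2 arcMeasure := fun k =>
    MemLp.of_bound (hcont k).aestronglyMeasurable 1 (.of_forall (hbound k))
  refine mem_hardy_of_tendsto (u := fun k => (hmem k).toLp) (C := 1)
    (fun k => mem_hardy_of_differentiableOn hFd (hr₀ k) (hr₁ k) (hmem k).coeFn_toLp)
    (fun k => ?_) ?_
  · filter_upwards [(hmem k).coeFn_toLp] with θ hθ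
    rw [hθ]
    exact hbound k θ
  · filter_upwards [ae_all_iff.2 fun k => (hmem k).coeFn_toLp, mulOp_singularInner_ae s
      (fourierLp 2 (n : ℤ)), coeFn_fourierLp (T := 2 * Real.pi) 2 (n : ℤ), ae_ne_zero]
      with θ h₁ h₂ h₃ h₄
    simp only [h₁]
    rw [h₂, h₃, fourier_natCast_apply]
    have hlim : Filter.Tendsto (fun k => (r k : ℂ) * fourier 1 θ) Filter.atTop
        (nhds (fourier 1 θ)) := by
      simpa using ((Complex.continuous_ofReal.tendsto 1).comp hr).mul_const (fourier 1 θ : ℂ)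
    exact (hFc _ (mt (fourier_one_eq_one_iff θ).1 h₄)).tendsto.comp hlim

theorem mulOp_singularInner_mem_hardy {s : ℝ} (hs : 0 ≤ s) {f : Lp ℂ 2 arcMeasure}
    (hf : f ∈ hardy) : mulOp (memLp_singularInner s).toLp f ∈ hardy := by
  have hle : hardy ≤ hardy.comap
      (mulOp (memLp_singularInner s).toLp : Lp ℂ 2 arcMeasure →ₗ[ℂ] Lp ℂ 2 arcMeasure) := by
    refine Submodule.topologicalClosure_minimal _ (Submodule.span_le.2 ?_)
      (isClosed_hardy.preimage (mulOp (memLp_singularInner s).toLp).continuous)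
    rintro _ ⟨n, rfl⟩
    exact mulOp_singularInner_fourierLp_mem_hardy hs n
  exact hle hf

theorem coe_toeplitzSingular {s : ℝ} (hs : 0 ≤ s) (f : hardy) :
    (toeplitzSingular s f : Lp ℂ 2 arcMeasure) = mulOp (memLp_singularInner s).toLp f :=
  congrArg Subtype.val (hardy.orthogonalProjectionOnto_mem_subspace_eq_self
    ⟨_, mulOp_singularInner_mem_hardy hs f.2⟩)

/-- For `s ≥ 0`, the operator `T_{Φ_s}` is multiplication by `Φ_s`. -/
theorem toeplitzSingular_ae {s : ℝ} (hs : 0 ≤ s) (f : hardy) :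
    (toeplitzSingular s f : Lp ℂ 2 arcMeasure) =ᵐ[arcMeasure]
      fun θ => singularInner s θ * (f : Lp ℂ 2 arcMeasure) θ := by
  rw [coe_toeplitzSingular hs]
  exact mulOp_singularInner_ae s f

theorem singularInner_add (s s' : ℝ) (θ : Angle) :
    singularInner (s + s') θ = singularInner s θ * singularInner s' θ := by
  rw [singularInner, singularInner, singularInner, ← Complex.exp_add, Complex.ofReal_add, add_mul]

theorem conj_singularInner_mul_self (s : ℝ) (θ : Angle) :
    conj (singularInner s θ) * singularInner s θ = 1 := by
  rw [mul_comm, Complex.mul_conj, Complex.normSq_eq_norm_sq, norm_singularInner]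
  norm_num

theorem toeplitzSingular_add {s s' : ℝ} (hs : 0 ≤ s) (hs' : 0 ≤ s') :
    toeplitzSingular (s + s') = toeplitzSingular s * toeplitzSingular s' := by
  ext1 f
  refine Subtype.ext (Lp.ext ?_)
  rw [mul_apply_eq_comp]
  filter_upwards [toeplitzSingular_ae (add_nonneg hs hs') f, toeplitzSingular_ae hs' f,
    toeplitzSingular_ae hs (toeplitzSingular s' f)] with θ h₁ h₂ h₃
  rw [h₁, h₃, h₂, singularInner_add, mul_assoc]

theorem norm_toeplitzSingular_apply {s : ℝ} (hs : 0 ≤ s) (f : hardy) :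
    ‖toeplitzSingular s f‖ = ‖f‖ := by
  change ‖(toeplitzSingular s f : Lp ℂ 2 arcMeasure)‖ = ‖(f : Lp ℂ 2 arcMeasure)‖
  refine le_antisymm (Lp.norm_le_norm_of_ae_le ?_) (Lp.norm_le_norm_of_ae_le ?_) <;>
  · filter_upwards [toeplitzSingular_ae hs f] with θ hθ
    rw [hθ, norm_mul, norm_singularInner, one_mul]

theorem isIsometricRep_coneRep (t : ℝ) : IsIsometricRep (coneRep t) where
  map_add a b := toeplitzSingular_add a.2.2 b.2.2
  isometry a := (AddMonoidHomClass.isometry_iff_norm (coneRep t a)).2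
    (norm_toeplitzSingular_apply a.2.2)

/-! ### The operators `T_{Φ_s}`, `s > 0`, are not unitary -/

theorem fourierCoeff_eq_zero_of_mem_hardy {f : Lp ℂ 2 arcMeasure} (hf : f ∈ hardy) {n : ℤ}
    (hn : n < 0) : fourierCoeff f n = 0 := by
  have hle : hardy ≤ LinearMap.ker (innerSL ℂ (fourierLp (T := 2 * Real.pi) 2 n)).toLinearMap := by
    refine Submodule.topologicalClosure_minimal _ (Submodule.span_le.2 ?_)
      (innerSL ℂ (fourierLp (T := 2 * Real.pi) 2 n)).isClosed_ker
    rintro _ ⟨m, rfl⟩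
    exact orthonormal_fourier.2 (by omega)
  rw [← fourierBasis_repr, fourierBasis.repr_apply_apply, coe_fourierBasis]
  exact hle hf

theorem fourierCoeff_conj (f : Angle → ℂ) (n : ℤ) :
    fourierCoeff (fun θ => conj (f θ)) n = conj (fourierCoeff f (-n)) := by
  rw [fourierCoeff, fourierCoeff, ← integral_conj]
  refine integral_congr_ae (.of_forall fun θ => ?_)
  simp only [smul_eq_mul, map_mul, neg_neg, ← fourier_neg]

/-- A function that lies in the Hardy space together with its conjugate is constant. -/
theorem ae_eq_const_of_mem_hardy_of_conj_mem_hardy {f g : Lp ℂ 2 arcMeasure} (hf : f ∈ hardy)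
    (hg : g ∈ hardy) (hfg : g =ᵐ[arcMeasure] fun θ => conj (f θ)) :
    ∃ c : ℂ, f =ᵐ[arcMeasure] fun _ => c := by
  have hcoeff : ∀ n : ℤ, n ≠ 0 → fourierCoeff f n = 0 := by
    intro n hn
    rcases lt_or_gt_of_ne hn with h | h
    · exact fourierCoeff_eq_zero_of_mem_hardy hf h
    · have := fourierCoeff_eq_zero_of_mem_hardy hg (neg_lt_zero.2 h)
      rw [fourierCoeff_congr_ae hfg, fourierCoeff_conj, neg_neg] at this
      exact (map_eq_zero _).1 this
  have hsum := (hasSum_fourier_series_L2 f).unique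
    (hasSum_single 0 fun n hn => by rw [hcoeff n hn, zero_smul])
  refine ⟨fourierCoeff f 0, ?_⟩
  have h₁ := Lp.coeFn_smul (fourierCoeff f 0) (fourierLp (T := 2 * Real.pi) 2 0)
  rw [← hsum] at h₁
  filter_upwards [h₁, coeFn_fourierLp (T := 2 * Real.pi) 2 0] with θ h₁ h₂
  rw [h₁, Pi.smul_apply, h₂, fourier_zero, smul_eq_mul, mul_one]

theorem exists_fourier_one_eq {w : ℂ} (hw : ‖w‖ = 1) : ∃ θ : Angle, (fourier 1 θ : ℂ) = w := by
  refine ⟨(Complex.arg w : ℝ), ?_⟩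
  rw [fourier_coe_apply]
  have h := Complex.norm_mul_exp_arg_mul_I w
  rw [hw, Complex.ofReal_one, one_mul] at h
  have hpi : (Real.pi : ℂ) ≠ 0 := by exact_mod_cast Real.pi_ne_zero
  refine Eq.trans (congrArg Complex.exp ?_) h
  push_cast
  field_simp

/-- By continuity off `θ = 0`, a function that is constant almost everywhere would be constant
there. But `Φ_s` takes the value `1` at `-1`, and the value `-1` where the exponent equals `iπ`. -/
theorem not_ae_eq_const_singularInner {s : ℝ} (hs : 0 < s) (c : ℂ) :
    ¬ singularInner s =ᵐ[arcMeasure] fun _ => c := by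
  intro h
  have hcont : ContinuousOn (singularInner s) {0}ᶜ := fun θ hθ =>
    ((continuousAt_exp_singular s (mt (fourier_one_eq_one_iff θ).1 hθ)).comp
      (f := fun θ : Angle => (fourier 1 θ : ℂ)) (fourier 1).continuous.continuousAt).continuousWithinAt
  have heq : Set.EqOn (singularInner s) (fun _ => c) {0}ᶜ :=
    Measure.eqOn_open_of_ae_eq (ae_restrict_of_ae h) isOpen_compl_singleton hcont
      continuousOn_const
  have hval : ∀ w : ℂ, ‖w‖ = 1 → w ≠ 1 → Complex.exp (s * ((w + 1) / (w - 1))) = c := by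
    intro w hw hw1
    obtain ⟨θ, rfl⟩ := exists_fourier_one_eq hw
    exact heq (mt (fourier_one_eq_one_iff θ).2 hw1)
  have h₁ : c = 1 := by
    rw [← hval (-1) (by simp) (by norm_num)]
    simp
  -- The map `w ↦ (w + 1) / (w - 1)` is an involution carrying imaginary numbers to the circle, so
  -- the point with exponent `s * q = iπ` is `(q + 1) / (q - 1)`.
  set q : ℂ := (Real.pi / s : ℝ) * Complex.I with hq
  have hqre : q.re = 0 := by simp [hq]
  have hq1 : q - 1 ≠ 0 := fun h => by
    have := congrArg Complex.re h
    simp [hqre] at this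
  have hw : (q + 1) / (q - 1) ≠ 1 := by
    rw [Ne, div_eq_one_iff_eq hq1]
    intro h
    have := congrArg Complex.re h
    simp [hqre] at this
    norm_num at this
  have hwn : ‖(q + 1) / (q - 1)‖ = 1 := by
    rw [norm_div, div_eq_one_iff_eq (norm_ne_zero_iff.2 hq1)]
    refine (pow_left_inj₀ (norm_nonneg _) (norm_nonneg _) two_ne_zero).1 ?_
    rw [← Complex.normSq_eq_norm_sq, ← Complex.normSq_eq_norm_sq, Complex.normSq_apply,
      Complex.normSq_apply]
    simp [hqre]
  have h₂ := hval _ hwn hw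
  have h₃ : ((q + 1) / (q - 1) + 1) / ((q + 1) / (q - 1) - 1) = q := by
    have : (q + 1) / (q - 1) - 1 ≠ 0 := sub_ne_zero.2 hw
    field_simp
    ring
  have hs' : (s : ℂ) ≠ 0 := by exact_mod_cast hs.ne'
  have h₄ : (s : ℂ) * q = Real.pi * Complex.I := by
    rw [hq]
    push_cast
    field_simp
  rw [h₃, h₄, Complex.exp_pi_mul_I, h₁] at h₂
  norm_num at h₂

/-- If `Φ_s g = 1` with `g` in `H²`, then `g` is the conjugate of `Φ_s`, since `|Φ_s| = 1`. Both
then lie in `H²`, so `Φ_s` is constant. -/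
theorem not_surjective_toeplitzSingular {s : ℝ} (hs : 0 < s) :
    ¬ Function.Surjective (toeplitzSingular s) := by
  intro hsurj
  set e : hardy := ⟨fourierLp 2 ((0 : ℕ) : ℤ), fourierLp_mem_hardy 0⟩ with he
  have he' : (e : Lp ℂ 2 arcMeasure) =ᵐ[arcMeasure] fun _ => 1 := by
    filter_upwards [coeFn_fourierLp (T := 2 * Real.pi) 2 ((0 : ℕ) : ℤ)] with θ hθ
    rw [he, hθ, Nat.cast_zero, fourier_zero]
  obtain ⟨g, hg⟩ := hsurj e
  have hΦ : (toeplitzSingular s e : Lp ℂ 2 arcMeasure) =ᵐ[arcMeasure] singularInner s := by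
    filter_upwards [toeplitzSingular_ae hs.le e, he'] with θ h₁ h₂
    rw [h₁, h₂, mul_one]
  have hg' : (g : Lp ℂ 2 arcMeasure) =ᵐ[arcMeasure]
      fun θ => conj ((toeplitzSingular s e : Lp ℂ 2 arcMeasure) θ) := by
    have h := toeplitzSingular_ae hs.le g
    rw [hg] at h
    filter_upwards [h, he', hΦ] with θ h₁ h₂ h₃
    rw [h₃, ← mul_one (conj _), ← h₂, h₁, ← mul_assoc, conj_singularInner_mul_self, one_mul]
  obtain ⟨c, hc⟩ := ae_eq_const_of_mem_hardy_of_conj_mem_hardy (toeplitzSingular s e).2 g.2 hg'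
  exact not_ae_eq_const_singularInner hs c (hΦ.symm.trans hc)

/-! ### The cone `Γ₊` -/

section Cone

variable {t : ℝ}

/-- The cone contains every nonnegative difference of its elements, so the order of `ℝ` is its
divisibility order. -/
instance (t : ℝ) : CanonicallyOrderedAdd (latticeCone t) where
  exists_add_of_le {a b} h := ⟨⟨b - a, sub_mem b.2.1 a.2.1, sub_nonneg.2 h⟩,
    Subtype.ext (add_sub_cancel (a : ℝ) b).symm⟩
  le_add_self _ b := le_add_of_nonneg_left (α := ℝ) b.2.2
  le_self_add _ b := le_add_of_nonneg_right (α := ℝ) b.2.2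

instance (t : ℝ) : Nontrivial (latticeCone t) :=
  ⟨⟨0, ⟨1, ⟨1, 0, by simp⟩, zero_le_one⟩, fun h => zero_ne_one (congrArg Subtype.val h)⟩⟩

theorem coordinates_unique (hirr : Irrational t) {v w : ℤ × ℤ}
    (h : (v.1 + v.2 * t : ℝ) = w.1 + w.2 * t) : v = w := by
  have hn : v.2 = w.2 := by
    by_contra hn
    have h₁ : ((v.2 - w.2 : ℤ) : ℝ) ≠ 0 := by exact_mod_cast sub_ne_zero.2 hn
    refine hirr ⟨(w.1 - v.1 : ℤ) / (v.2 - w.2 : ℤ), ?_⟩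
    rw [Rat.cast_div, Rat.cast_intCast, Rat.cast_intCast, div_eq_iff h₁]
    push_cast
    linear_combination -h
  refine Prod.ext ?_ hn
  rw [hn] at h
  have hm : (v.1 : ℝ) = w.1 := by linear_combination h
  exact Int.cast_injective hm

theorem exists_coordinates (γ : latticeCone t) : ∃ v : ℤ × ℤ, (γ : ℝ) = v.1 + v.2 * t := by
  obtain ⟨m, n, h⟩ := γ.2.1
  exact ⟨(m, n), h⟩

/-- The coordinates `(m, n)` of `m + n t`. -/
def coordinates (t : ℝ) (γ : latticeCone t) : ℤ × ℤ :=
  (exists_coordinates γ).choose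

theorem coordinates_spec (γ : latticeCone t) :
    (γ : ℝ) = (coordinates t γ).1 + (coordinates t γ).2 * t :=
  (exists_coordinates γ).choose_spec

/-- The coordinates, as a homomorphism. -/
def coordinatesHom (hirr : Irrational t) : latticeCone t →+ ℤ × ℤ where
  toFun := coordinates t
  map_zero' := by
    refine coordinates_unique hirr ?_
    rw [← coordinates_spec]
    simp
  map_add' a b := by
    refine coordinates_unique hirr ?_
    rw [← coordinates_spec, AddSubmonoid.coe_add, coordinates_spec a, coordinates_spec b]
    push_cast [Prod.fst_add, Prod.snd_add]
    ring

theorem coordinatesHom_injective (hirr : Irrational t) :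
    Function.Injective (coordinatesHom hirr) := by
  intro a b h
  have h' : coordinates t a = coordinates t b := h
  exact Subtype.ext (by rw [coordinates_spec a, coordinates_spec b, h'])

end Cone

/-! ### The generators -/

section Generators

variable {B : Type*} [Ring B] [StarRing B] {T : ℝ → B}

theorem map_natCast_mul_eq_pow (h₀ : T 0 = 1)
    (hadd : ∀ s s', 0 ≤ s → 0 ≤ s' → T (s + s') = T s * T s') {s : ℝ} (hs : 0 ≤ s) (n : ℕ) :
    T (n * s) = T s ^ n := by
  induction n with
  | zero => rw [Nat.cast_zero, zero_mul, pow_zero, h₀]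
  | succ n ih => rw [Nat.cast_succ, add_mul, one_mul, hadd _ _ (by positivity) hs, ih, pow_succ]

theorem map_sub_eq_star_mul (hadd : ∀ s s', 0 ≤ s → 0 ≤ s' → T (s + s') = T s * T s')
    (hiso : ∀ s, 0 ≤ s → star (T s) * T s = 1) {s s' : ℝ} (hs' : 0 ≤ s') (h : s' ≤ s) :
    T (s - s') = star (T s') * T s := by
  conv_rhs => rw [← add_sub_cancel s' s, hadd _ _ hs' (sub_nonneg.2 h), ← mul_assoc, hiso s' hs',
    one_mul]

/-- A one-parameter semigroup of isometries maps `Γ₊` into any star algebra that contains its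
values at `1` and `t`. -/
theorem map_mem_of_mem_latticeCone [Algebra ℂ B] [StarModule ℂ B] (h₀ : T 0 = 1)
    (hadd : ∀ s s', 0 ≤ s → 0 ≤ s' → T (s + s') = T s * T s')
    (hiso : ∀ s, 0 ≤ s → star (T s) * T s = 1) {t : ℝ} (ht : 0 < t) {A : StarSubalgebra ℂ B}
    (h₁ : T 1 ∈ A) (ht' : T t ∈ A) {x : ℝ} (hx : x ∈ latticeCone t) : T x ∈ A := by
  obtain ⟨⟨m, n, rfl⟩, hx⟩ := hx
  have hm : ∀ k : ℕ, T k ∈ A := fun k => by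
    have := map_natCast_mul_eq_pow h₀ hadd zero_le_one k
    rw [mul_one] at this
    exact this ▸ pow_mem h₁ k
  have hn : ∀ k : ℕ, T (k * t) ∈ A := fun k =>
    map_natCast_mul_eq_pow h₀ hadd ht.le k ▸ pow_mem ht' k
  obtain ⟨k, rfl | rfl⟩ := m.eq_nat_or_neg <;> obtain ⟨l, rfl | rfl⟩ := n.eq_nat_or_neg <;>
    push_cast at hx ⊢
  · rw [hadd _ _ (by positivity) (by positivity)]
    exact mul_mem (hm k) (hn l)
  · rw [neg_mul, ← sub_eq_add_neg] at hx ⊢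
    rw [map_sub_eq_star_mul hadd hiso (by positivity) (sub_nonneg.1 hx)]
    exact mul_mem (star_mem (hn l)) (hm k)
  · rw [neg_add_eq_sub] at hx ⊢
    rw [map_sub_eq_star_mul hadd hiso (by positivity) (sub_nonneg.1 hx)]
    exact mul_mem (star_mem (hm k)) (hn l)
  -- Both coefficients are nonpositive, so a nonnegative sum must be `0`.
  · have hk : (0 : ℝ) ≤ k := k.cast_nonneg
    have hl : (0 : ℝ) ≤ l * t := by positivity
    have h : -(k : ℝ) + -(l : ℝ) * t = 0 := le_antisymm (by linarith) hx
    rw [h, h₀]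
    exact one_mem A

theorem cstarGenerated_le {H : Type*} [NormedAddCommGroup H] [InnerProductSpace ℂ H]
    [CompleteSpace H] {s s' : Set (H →L[ℂ] H)} (h : s ⊆ StarAlgebra.adjoin ℂ s') :
    cstarGenerated s ≤ cstarGenerated s' :=
  StarSubalgebra.topologicalClosure_mono (StarAlgebra.adjoin_le h)

end Generators

theorem toeplitzSingular_zero : toeplitzSingular 0 = 1 :=
  (isIsometricRep_coneRep 0).isIsometricHom.map_zero

theorem star_toeplitzSingular_mul_self (s : ℝ) (hs : 0 ≤ s) :
    star (toeplitzSingular s) * toeplitzSingular s = 1 :=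
  (toeplitzSingular s).norm_map_iff_adjoint_comp_self.1 (norm_toeplitzSingular_apply hs)

/-- Mixed signs are handled by `T_{s-s'} = star T_{s'} * T_s`, so each `T_γ` already lies in the
star algebra of the two generators before closure. -/
theorem cstarRep_coneRep {t : ℝ} (ht : 0 < t) :
    cstarRep (coneRep t) = cstarGenerated {toeplitzSingular 1, toeplitzSingular t} := by
  refine le_antisymm (cstarGenerated_le ?_)
    (cstarGenerated_le (Set.Subset.trans ?_ (StarAlgebra.subset_adjoin ℂ _)))
  · rintro _ ⟨γ, rfl⟩
    exact map_mem_of_mem_latticeCone toeplitzSingular_zero (fun _ _ => toeplitzSingular_add)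
      star_toeplitzSingular_mul_self ht (StarAlgebra.subset_adjoin ℂ _ (Set.mem_insert _ _))
      (StarAlgebra.subset_adjoin ℂ _ (Set.mem_insert_of_mem _ (Set.mem_singleton _))) γ.2
  · rintro _ (rfl | rfl)
    · exact ⟨⟨1, ⟨1, 0, by simp⟩, zero_le_one⟩, rfl⟩
    · exact ⟨⟨t, ⟨0, 1, by simp⟩, ht.le⟩, rfl⟩

theorem canonicallyIsomorphic_coneRep {t : ℝ} (hirr : Irrational t) :
    CanonicallyIsomorphic (coneRep t) (regularRep (S := latticeCone t)) :=
  canonicallyIsomorphic_regularRep (coordinatesHom_injective hirr) (isIsometricRep_coneRep t)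
    fun a ha => not_surjective_toeplitzSingular
      (lt_of_le_of_ne a.2.2 fun h => ha (Subtype.ext h.symm))

end ToeplitzExt

end

theorem mainTheorem7 (t : ℝ) (ht : 0 < t) (hirr : Irrational t) :
    -- `T_{Φ_s}` is multiplication by `Φ_s` on `H²`, for every `s ≥ 0`
    (∀ s : ℝ, 0 ≤ s → ∀ f : ToeplitzExt.hardy,
      ((ToeplitzExt.toeplitzSingular s f : ToeplitzExt.hardy) :
          MeasureTheory.Lp ℂ 2 ToeplitzExt.arcMeasure)
        =ᵐ[ToeplitzExt.arcMeasure] fun θ => ToeplitzExt.singularInner s θ *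
          (f : MeasureTheory.Lp ℂ 2 ToeplitzExt.arcMeasure) θ) ∧
    -- `m + n t ↦ T_{Φ_{m + n t}}` is an isometric representation of `Γ₊` on `H²`
    ToeplitzExt.IsIsometricRep (ToeplitzExt.coneRep t) ∧
    -- the C*-algebra that it generates is `C*(T_{Φ_1}, T_{Φ_t})`
    ToeplitzExt.cstarRep (ToeplitzExt.coneRep t) =
      ToeplitzExt.cstarGenerated
        {ToeplitzExt.toeplitzSingular 1, ToeplitzExt.toeplitzSingular t} ∧
    -- and it is canonically isomorphic to `C*_red(Γ₊)`
    ToeplitzExt.CanonicallyIsomorphic (ToeplitzExt.coneRep t)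
      (ToeplitzExt.regularRep (S := ToeplitzExt.latticeCone t)) := by
  exact ⟨fun _ hs f => ToeplitzExt.toeplitzSingular_ae hs f, ToeplitzExt.isIsometricRep_coneRep t,
    ToeplitzExt.cstarRep_coneRep ht, ToeplitzExt.canonicallyIsomorphic_coneRep hirr⟩
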